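/- Function spaces are on $[0,1]$ with Lebesgue measure $m$. A Banach function lattice $X$ is a Banach space of (classes of) real measurable functions on $[0,1]$ such that $|f|\le|g|$ a.e., $f$ measurable and $g\in X$ imply $f\in X$ and $\|f\|_X\le\|g\|_X$. It is a rearrangement invariant (r.i.) space if, in addition, $g\in X$ and $m\{|f|>\tau\}=m\{|g|>\tau\}$ for all $\tau>0$ imply $f\in X$ and $\|f\|_X=\|g\|_X$, and if $X$ is separable or maximal (that is, $X=X''$ isometrically, where $X'$ is the Köthe dual, normed by $\|f\|_{X'}=\sup\{\int|fg|:\|g\|_X\le1\}$). A sequence in a Banach space $A$ is complemented in $A$ if its closed linear span is the range of a bounded projection in $A$. A Banach lattice is disjointly complemented (DC) if every sequence of pairwise disjoint elements has a complemented subsequence. Let $X_0,X_1$ be r.i. spaces on $[0,1]$ with $X_0\subset X_1$, such that this embedding is strict: if $x_n\in X_0$, $\sup_n\|x_n\|_{X_0}<\infty$ and $m(\operatorname{supp}x_n)\to0$, then $\|x_n\|_{X_1}\to0$. Assume that $\|x\|_{X_1}\le\|x\|_{X_0}$ for $x\in X_0$ and $\|\chi_{[0,1]}\|_{X_0}=\|\chi_{[0,1]}\|_{X_1}=1$.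 Let $E$ be a Banach space with a normalized $1$-unconditional basis $\{e_n\}_{n=1}^\infty$, regarded as a Banach lattice with the coordinatewise order. Let $(m_n)_{n=1}^\infty$ be an increasing sequence with $m_1\ge2$, $\sum_n m_n^{-1}<\infty$ and $$m_n^{-1}\sum_{i=1}^{n-1}m_i+m_n\sum_{i=n+1}^\infty m_i^{-1}<2^{-n-1},\qquad n=1,2,\dots$$ For $f\in X_0+X_1$ put $k_n(f)=\inf\{m_n^{-1}\|f_0\|_{X_0}+m_n\|f_1\|_{X_1}: f=f_0+f_1,\ f_i\in X_i\}$, and let $W=W_E^K(X_0,X_1)$ be the Lions--Peetre space of all $f\in X_0+X_1$ for which $\sum_n k_n(f)e_n$ converges in $E$, with $\|f\|_W=\big\|\sum_n k_n(f)e_n\big\|_E$. Then $W$ is an r.i. space, and the following are equivalent: (a) $E$ is a DC lattice; (b) every block basis of $\{e_n\}$ (a sequence of non-zero vectors $u_j=\sum_{k=p_j}^{p_{j+1}-1}a_ke_k$ with $p_1<p_2<\cdots$) has a subsequence complemented in $E$; (c) $W$ is a DC r.i. space. -/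

import Mathlib

open MeasureTheory Filter Topology
open scoped ENNReal unitInterval

noncomputable section

/-- Real-valued Lebesgue measurable functions on `[0,1]`, modulo equality almost everywhere. -/
abbrev L0 : Type := I →ₘ[(volume : Measure I)] ℝ

/-- A Banach function lattice on `[0,1]`: a linear space of (classes of) measurable functions with
a complete norm satisfying the ideal property. -/
structure BanachFunctionLattice where
  /-- the underlying linear space of functions -/
  carrier : Submodule ℝ L0
  /-- the norm -/
  nrm : carrier → ℝ
  nrm_eq_zero : ∀ f, nrm f = 0 → f = 0
  nrm_smul : ∀ (c : ℝ) (f : carrier), nrm (c • f) = |c| * nrm f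
  nrm_add_le : ∀ f g, nrm (f + g) ≤ nrm f + nrm g
  ideal : ∀ f g : L0, |f| ≤ |g| → g ∈ carrier → f ∈ carrier
  nrm_le : ∀ f g : carrier, |(f : L0)| ≤ |(g : L0)| → nrm f ≤ nrm g
  complete : ∀ u : ℕ → carrier,
    (∀ ε > 0, ∃ N, ∀ m ≥ N, ∀ n ≥ N, nrm (u m - u n) < ε) →
      ∃ f, Tendsto (fun n => nrm (u n - f)) atTop (𝓝 0)

namespace BanachFunctionLattice

variable (X : BanachFunctionLattice)

instance : CoeSort BanachFunctionLattice Type := ⟨fun X => X.carrier⟩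

instance : Norm X := ⟨X.nrm⟩

theorem core : NormedSpace.Core ℝ X where
  norm_nonneg f := by
    change 0 ≤ X.nrm f
    have h1 := X.nrm_add_le f ((-1 : ℝ) • f)
    have h2 := X.nrm_smul (-1) f
    have h3 : f + (-1 : ℝ) • f = (0 : ℝ) • f := by module
    have h4 := X.nrm_smul 0 f
    rw [h3, h4, h2] at h1
    norm_num at h1
    linarith
  norm_smul c f := X.nrm_smul c f
  norm_triangle f g := X.nrm_add_le f g
  norm_eq_zero_iff f := by
    refine ⟨X.nrm_eq_zero f, ?_⟩
    rintro rfl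
    have h4 := X.nrm_smul 0 (0 : X.carrier)
    rw [zero_smul] at h4
    exact h4.trans (by simp)

instance : NormedAddCommGroup X := NormedAddCommGroup.ofCore X.core

instance : NormedSpace ℝ X := NormedSpace.ofCore X.core

instance : CompleteSpace X := by
  refine Metric.complete_of_cauchySeq_tendsto fun u hu => ?_
  obtain ⟨f, hf⟩ := X.complete u (by
    intro ε hε
    obtain ⟨N, hN⟩ := Metric.cauchySeq_iff.1 hu ε hε
    exact ⟨N, fun m hm n hn => by
      have := hN m hm n hn
      rwa [dist_eq_norm] at this⟩)
  exact ⟨f, tendsto_iff_norm_sub_tendsto_zero.2 hf⟩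

theorem sup_mem {f g : L0} (hf : f ∈ X.carrier) (hg : g ∈ X.carrier) : f ⊔ g ∈ X.carrier := by
  have habs : ∀ {u : L0}, u ∈ X.carrier → |u| ∈ X.carrier := fun {u} hu => by
    refine X.ideal _ u ?_ hu
    rw [← AEEqFun.coeFn_le]
    filter_upwards [AEEqFun.coeFn_abs u, AEEqFun.coeFn_abs |u|] with t h1 h2
    rw [h2, h1, abs_abs]
  refine X.ideal _ (|f| + |g|) ?_ (X.carrier.add_mem (habs hf) (habs hg))
  rw [← AEEqFun.coeFn_le]
  filter_upwards [AEEqFun.coeFn_abs (f ⊔ g), AEEqFun.coeFn_abs (|f| + |g|), AEEqFun.coeFn_sup f g,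
    AEEqFun.coeFn_add |f| |g|, AEEqFun.coeFn_abs f, AEEqFun.coeFn_abs g] with t h1 h2 h3 h4 h5 h6
  rw [h1, h2, h3, h4, Pi.add_apply, h5, h6]
  refine le_trans ?_ (le_abs_self _)
  rcases le_total (f t) (g t) with h | h
  · rw [sup_eq_right.2 h]; exact le_add_of_nonneg_left (abs_nonneg _)
  · rw [sup_eq_left.2 h]; exact le_add_of_nonneg_right (abs_nonneg _)

theorem inf_mem {f g : L0} (hf : f ∈ X.carrier) (hg : g ∈ X.carrier) : f ⊓ g ∈ X.carrier := by
  have h : f ⊓ g = -(-f ⊔ -g) := by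
    apply AEEqFun.ext
    filter_upwards [AEEqFun.coeFn_inf f g, AEEqFun.coeFn_neg (-f ⊔ -g), AEEqFun.coeFn_sup (-f) (-g),
      AEEqFun.coeFn_neg f, AEEqFun.coeFn_neg g] with t h1 h2 h3 h4 h5
    rw [h1, h2, Pi.neg_apply, h3, h4, h5, Pi.neg_apply, Pi.neg_apply, max_neg_neg, neg_neg]
  rw [h]
  exact X.carrier.neg_mem (X.sup_mem (X.carrier.neg_mem hf) (X.carrier.neg_mem hg))

/-- The pointwise almost everywhere order of a Banach function lattice. -/
instance : Lattice X :=
  Subtype.lattice (P := fun f : L0 => f ∈ X.carrier) (fun _ _ => X.sup_mem) (fun _ _ => X.inf_mem)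

open scoped Classical in
/-- The norm of `X`, extended to all measurable functions by `∞` outside `X`. -/
def extNorm (f : L0) : ℝ≥0∞ :=
  if h : f ∈ X.carrier then ENNReal.ofReal ‖(⟨f, h⟩ : X)‖ else ⊤

/-- The fundamental function `φ_X(t) = ‖χ_{[0,t]}‖_X`. -/
def fundamental (t : ℝ) : ℝ≥0∞ :=
  X.extNorm (AEEqFun.mk (Set.indicator {s : I | (s : ℝ) ≤ t} fun _ => (1 : ℝ))
    ((measurable_const.indicator
      (measurableSet_le measurable_subtype_coe measurable_const)).aestronglyMeasurable))

/-- `X` is separable. -/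
def IsSeparable : Prop := TopologicalSpace.SeparableSpace X

end BanachFunctionLattice

/-- The Köthe dual of an extended norm `N` on measurable functions. -/
def koetheDual (N : L0 → ℝ≥0∞) (f : L0) : ℝ≥0∞ :=
  ⨆ (g : L0) (_ : N g ≤ 1), ∫⁻ t, ‖f t * g t‖ₑ

/-- `X` is maximal: it coincides, with equality of norms, with its second Köthe dual. -/
def BanachFunctionLattice.IsMaximal (X : BanachFunctionLattice) : Prop :=
  koetheDual (koetheDual X.extNorm) = X.extNorm

/-- Equimeasurable functions. -/
def Equimeasurable (f g : L0) : Prop :=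
  ∀ τ : ℝ, 0 < τ → volume {t : I | τ < |f t|} = volume {t : I | τ < |g t|}

/-- A rearrangement invariant space on `[0,1]`: a rearrangement invariant Banach function lattice
which is separable or maximal. -/
structure RISpace extends BanachFunctionLattice where
  rearrange : ∀ f g : L0, Equimeasurable f g → g ∈ carrier → f ∈ carrier
  nrm_rearrange : ∀ f g : carrier, Equimeasurable (f : L0) (g : L0) → nrm f = nrm g
  separable_or_maximal : toBanachFunctionLattice.IsSeparable ∨ toBanachFunctionLattice.IsMaximal

instance : CoeSort RISpace Type := ⟨fun X => X.toBanachFunctionLattice⟩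

/-- The embedding `X₀ ⊂ X₁` is strict: sequences bounded in `X₀` whose supports have measures
tending to zero tend to zero in `X₁`. -/
def StrictlyEmbedded (X₀ X₁ : RISpace) : Prop :=
  ∃ h : X₀.carrier ≤ X₁.carrier, ∀ x : ℕ → X₀,
    (∃ C : ℝ, ∀ n, ‖x n‖ ≤ C) →
    Tendsto (fun n => volume {t : I | (x n : L0) t ≠ 0}) atTop (𝓝 0) →
    Tendsto (fun n => ‖(Submodule.inclusion h (x n) : X₁)‖) atTop (𝓝 0)

/-- The Peetre K-functional `k(α, β, f; X₀, X₁)` (for `f ∈ X₀ + X₁`). -/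
def kFunctional (X₀ X₁ : RISpace) (α β : ℝ) (f : L0) : ℝ :=
  sInf {r : ℝ | ∃ (f₀ : X₀) (f₁ : X₁), f = (f₀ : L0) + (f₁ : L0) ∧ r = α * ‖f₀‖ + β * ‖f₁‖}

section Sequence

variable {E : Type*} [NormedAddCommGroup E] [NormedSpace ℝ E]

/-- A normalized 1-unconditional basis: changing signs of coefficients does not change norms. -/
structure IsNormalizedOneUnconditional (e : SchauderBasis ℝ E) : Prop where
  norm_basis : ∀ n, ‖e n‖ = 1
  norm_signs : ∀ (s : Finset ℕ) (a θ : ℕ → ℝ), (∀ n, θ n = 1 ∨ θ n = -1) →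
    ‖∑ n ∈ s, (θ n * a n) • e n‖ = ‖∑ n ∈ s, a n • e n‖

/-- `u` is a block basis of `e`. -/
def IsBlockBasis (e : SchauderBasis ℝ E) (u : ℕ → E) : Prop :=
  ∃ (p : ℕ → ℕ) (a : ℕ → ℝ), StrictMono p ∧
    ∀ j, u j = ∑ k ∈ Finset.Ico (p j) (p (j + 1)), a k • e k ∧ u j ≠ 0

/-- A sequence is complemented if its closed linear span is the range of a bounded projection. -/
def IsComplementedSeq (u : ℕ → E) : Prop :=
  (Submodule.span ℝ (Set.range u)).topologicalClosure.ClosedComplemented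

/-- A Banach lattice is disjointly complemented (DC) if every sequence of pairwise disjoint
elements has a complemented subsequence. -/
def IsDC (E : Type*) [NormedAddCommGroup E] [NormedSpace ℝ E] [Lattice E] : Prop :=
  ∀ x : ℕ → E, (∀ i j, i ≠ j → |x i| ⊓ |x j| = 0) →
    ∃ φ : ℕ → ℕ, StrictMono φ ∧ IsComplementedSeq (x ∘ φ)

/-- `W` is the Lions-Peetre space `W_E^K(X₀, X₁, (α n), (β n))`: it consists of all
`f ∈ X₀ + X₁` for which the series `∑ k(α n, β n, f; X₀, X₁) e n` converges in `E`, and the norm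
of `f` is the norm in `E` of the sum of this series. -/
structure IsLionsPeetre (e : SchauderBasis ℝ E) (X₀ X₁ : RISpace) (α β : ℕ → ℝ)
    (W : BanachFunctionLattice) : Prop where
  mem_iff : ∀ f : L0, f ∈ W.carrier ↔ f ∈ X₀.carrier ⊔ X₁.carrier ∧
    Summable (fun n => kFunctional X₀ X₁ (α n) (β n) f • e n) (SummationFilter.conditional ℕ)
  nrm_eq : ∀ f : W,
    ‖f‖ = ‖∑'[SummationFilter.conditional ℕ] n, kFunctional X₀ X₁ (α n) (β n) (f : L0) • e n‖

end Sequence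

end

/-! The space `W` and the lattice `E` resemble each other because the K-functionals `k_n` are
seminorms on `W` whose sequence of values, measured in `E`, is the norm. Both nontrivial
implications transfer complementation along an operator `Y` that is bounded below on the span of a
sequence: if `Y x_j` has complemented span, so has `x_j` (`IsComplementedSeq.of_map`).

From block bases to disjoint sequences (`exists_isComplementedSeq`): let `x_j` be normalized and
disjoint with `k_n(x_j) → 0` for each `n`. A gliding hump gives a subsequence whose sequences
`k_n(x_j)` live, up to small errors, on consecutive blocks. The block parts `v_j` satisfy `‖∑ c_j
x_j‖ ≤ 2 ‖∑ c_j v_j‖`. Conversely, for `n` in the `j`-th block, Hahn–Banach gives a functional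
dominated by `k_n` and attaining it at `x_j`. Composed with the restriction to the support of `x_j`,
these functionals are the coordinates of a bounded `Y` with `Y x_j = v_j`. Taking `k_n` to be the
absolute values of coordinates, the same argument covers `E` itself. In `W` the condition `k_n(x_j)
→ 0` is where the strict embedding enters: disjoint supports shrink, so the `X₀`-parts of
near-optimal decompositions vanish in `X₁`.

From `W` to block bases: disjoint multiples `g_n` of indicators of dyadic intervals have `k_n(g_n)`
between `1/8` and `1`, while the lacunarity of `m` makes the other `k_i(g_n)` summably small. Hence
`e_n ↦ g_n` extends to an isomorphic embedding of `E` into `W` taking block bases to disjoint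
sequences.

Rearrangement invariance of `W` follows from that of each `k_n`: equimeasurable `f`, `g` satisfy
`|f| ≤ |g ∘ τ| + ε` with `τ` measure preserving. Of the two alternatives in the definition of an
r.i. space, separability is the one established; it comes from absolute continuity of the norm. -/

noncomputable section

/-! ### Multipliers, supports and disjointness of measurable functions. -/

namespace L0

theorem coeFn_zero : ∀ᵐ t, (0 : L0) t = 0 :=
  AEEqFun.coeFn_zero

theorem abs_le_abs_iff {f g : L0} : |f| ≤ |g| ↔ ∀ᵐ t, |f t| ≤ |g t| := by
  rw [← AEEqFun.coeFn_le]
  constructor <;> intro h <;>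
    filter_upwards [h, AEEqFun.coeFn_abs f, AEEqFun.coeFn_abs g] with t h h1 h2
  · rwa [h1, h2] at h
  · rwa [h1, h2]

theorem abs_abs_eq (f : L0) : |(|f|)| = |f| := by
  apply AEEqFun.ext
  filter_upwards [AEEqFun.coeFn_abs f, AEEqFun.coeFn_abs |f|] with t h1 h2
  rw [h2, h1, abs_abs]

/-- Multiplication by a fixed measurable function. -/
def mulLeft (h : L0) : L0 →ₗ[ℝ] L0 where
  toFun f := h * f
  map_add' f g := by
    apply AEEqFun.ext
    filter_upwards [AEEqFun.coeFn_mul h (f + g), AEEqFun.coeFn_mul h f, AEEqFun.coeFn_mul h g,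
      AEEqFun.coeFn_add f g, AEEqFun.coeFn_add (h * f) (h * g)] with t h1 h2 h3 h4 h5
    simp only [h1, h2, h3, h4, h5, Pi.mul_apply, Pi.add_apply]
    ring
  map_smul' c f := by
    apply AEEqFun.ext
    filter_upwards [AEEqFun.coeFn_mul h (c • f), AEEqFun.coeFn_mul h f,
      AEEqFun.coeFn_smul c f, AEEqFun.coeFn_smul c (h * f)] with t h1 h2 h3 h4
    simp only [RingHom.id_apply, h1, h2, h3, h4, Pi.mul_apply, Pi.smul_apply, smul_eq_mul]
    ring

theorem coeFn_mulLeft (h f : L0) : ∀ᵐ t, mulLeft h f t = h t * f t :=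
  AEEqFun.coeFn_mul h f

theorem abs_mulLeft_le {h : L0} (hh : ∀ᵐ t, |h t| ≤ 1) (f : L0) : |mulLeft h f| ≤ |f| := by
  rw [abs_le_abs_iff]
  filter_upwards [coeFn_mulLeft h f, hh] with t h1 h2
  rw [h1, abs_mul]
  exact mul_le_of_le_one_left (abs_nonneg _) h2

/-- The multiplier is `f / g`, with `x / 0 = 0`. It turns domination into an operator contractive in
every Banach function lattice, so it acts on both terms of a decomposition `f₀ + f₁` at once. -/
theorem exists_mulLeft_eq {f g : L0} (hfg : |f| ≤ |g|) :
    ∃ h : L0, (∀ᵐ t, |h t| ≤ 1) ∧ mulLeft h g = f := by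
  rw [abs_le_abs_iff] at hfg
  have hm : AEStronglyMeasurable (fun t => f t / g t) (volume : Measure I) :=
    (f.measurable.div g.measurable).aestronglyMeasurable
  refine ⟨AEEqFun.mk _ hm, ?_, ?_⟩
  · filter_upwards [AEEqFun.coeFn_mk _ hm, hfg] with t h1 h2
    rw [h1, abs_div]
    exact div_le_one_of_le₀ h2 (abs_nonneg _)
  · apply AEEqFun.ext
    filter_upwards [AEEqFun.coeFn_mk _ hm, hfg, coeFn_mulLeft (AEEqFun.mk _ hm) g] with t h1 h2 h3
    rw [h3, h1]
    by_cases hg : g t = 0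
    · rw [hg, abs_zero] at h2
      rw [hg, mul_zero, abs_nonpos_iff.1 h2]
    · rw [div_mul_cancel₀ _ hg]

/-- The indicator function of a measurable set. -/
def ind {A : Set I} (hA : MeasurableSet A) : L0 :=
  AEEqFun.mk (A.indicator fun _ => (1 : ℝ)) (measurable_const.indicator hA).aestronglyMeasurable

theorem coeFn_ind {A : Set I} (hA : MeasurableSet A) :
    ∀ᵐ t, ind hA t = A.indicator (fun _ => (1 : ℝ)) t :=
  AEEqFun.coeFn_mk _ _

theorem abs_ind_le_one {A : Set I} (hA : MeasurableSet A) : ∀ᵐ t, |ind hA t| ≤ 1 := by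
  filter_upwards [coeFn_ind hA] with t h
  by_cases ht : t ∈ A <;> simp [h, ht]

theorem measurableSet_support (f : L0) : MeasurableSet {t | f t ≠ 0} :=
  (measurableSet_eq_fun f.measurable measurable_const).compl

theorem mulLeft_ind_support (f : L0) : mulLeft (ind (measurableSet_support f)) f = f := by
  apply AEEqFun.ext
  filter_upwards [coeFn_mulLeft (ind (measurableSet_support f)) f,
    coeFn_ind (measurableSet_support f)] with t h1 h2
  rw [h1, h2]
  by_cases h : f t = 0 <;> simp [h]

theorem mulLeft_ind_support_of_disjoint {f g : L0} (h : ∀ᵐ t, f t = 0 ∨ g t = 0) :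
    mulLeft (ind (measurableSet_support f)) g = 0 := by
  apply AEEqFun.ext
  filter_upwards [coeFn_mulLeft (ind (measurableSet_support f)) g,
    coeFn_ind (measurableSet_support f), h, coeFn_zero] with t h1 h2 h3 h4
  rw [h1, h2, h4]
  rcases h3 with h | h <;> simp [h]

theorem abs_inf_abs_eq_zero_iff {f g : L0} :
    |f| ⊓ |g| = 0 ↔ ∀ᵐ t, f t = 0 ∨ g t = 0 := by
  have key : |f| ⊓ |g| = 0 ↔ ∀ᵐ t, (|f| ⊓ |g|) t = 0 := by
    constructor
    · intro h
      filter_upwards [coeFn_zero] with t h0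
      rw [h, h0]
    · intro h
      apply AEEqFun.ext
      filter_upwards [h, coeFn_zero] with t h h0
      rw [h, h0]
  rw [key]
  refine eventually_congr ?_
  filter_upwards [AEEqFun.coeFn_inf |f| |g|, AEEqFun.coeFn_abs f, AEEqFun.coeFn_abs g]
    with t h1 h2 h3
  rw [h1, h2, h3]
  constructor
  · intro h
    rcases min_choice |f t| |g t| with h' | h'
    · left; rw [← abs_eq_zero, ← h']; exact h
    · right; rw [← abs_eq_zero, ← h']; exact h
  · rintro (h | h) <;> simp [h]

end L0

/-! ### Multiplication operators in Banach function lattices. -/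

namespace BanachFunctionLattice

variable (X : BanachFunctionLattice)

theorem mulLeft_mem {h f : L0} (hh : ∀ᵐ t, |h t| ≤ 1) (hf : f ∈ X.carrier) :
    L0.mulLeft h f ∈ X.carrier :=
  X.ideal _ _ (L0.abs_mulLeft_le hh f) hf

theorem norm_le_of_abs_le {f g : X} (h : |(f : L0)| ≤ |(g : L0)|) : ‖f‖ ≤ ‖g‖ :=
  X.nrm_le f g h

/-- Multiplication by a function bounded by one as an operator in a Banach function lattice. -/
def mulOp (h : L0) (hh : ∀ᵐ t, |h t| ≤ 1) : X →ₗ[ℝ] X :=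
  (L0.mulLeft h).restrict fun _ hf => X.mulLeft_mem hh hf

theorem norm_mulOp_le (h : L0) (hh : ∀ᵐ t, |h t| ≤ 1) (f : X) : ‖X.mulOp h hh f‖ ≤ ‖f‖ :=
  X.norm_le_of_abs_le (L0.abs_mulLeft_le hh f)

theorem extNorm_of_mem {f : L0} (hf : f ∈ X.carrier) :
    X.extNorm f = ENNReal.ofReal ‖(⟨f, hf⟩ : X)‖ := by
  simp [extNorm, hf]

theorem mem_of_extNorm_ne_top {f : L0} (hf : X.extNorm f ≠ ⊤) : f ∈ X.carrier := by
  by_contra h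
  simp [extNorm, h] at hf

end BanachFunctionLattice

/-! ### Elementary properties of the K-functional. -/

section KFunctional

variable {X₀ X₁ : RISpace} {α β : ℝ}

theorem kFunctional_bddBelow (hα : 0 ≤ α) (hβ : 0 ≤ β) (f : L0) :
    BddBelow {r : ℝ | ∃ (f₀ : X₀) (f₁ : X₁), f = (f₀ : L0) + (f₁ : L0) ∧
      r = α * ‖f₀‖ + β * ‖f₁‖} := by
  refine ⟨0, ?_⟩
  rintro r ⟨f₀, f₁, -, rfl⟩
  positivity

theorem kFunctional_nonneg (hα : 0 ≤ α) (hβ : 0 ≤ β) (f : L0) :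
    0 ≤ kFunctional X₀ X₁ α β f := by
  refine Real.sInf_nonneg ?_
  rintro r ⟨f₀, f₁, -, rfl⟩
  positivity

theorem kFunctional_le (hα : 0 ≤ α) (hβ : 0 ≤ β) {f : L0} (f₀ : X₀) (f₁ : X₁)
    (h : f = (f₀ : L0) + (f₁ : L0)) : kFunctional X₀ X₁ α β f ≤ α * ‖f₀‖ + β * ‖f₁‖ :=
  csInf_le (kFunctional_bddBelow hα hβ f) ⟨f₀, f₁, h, rfl⟩

theorem kFunctional_le_left (hα : 0 ≤ α) (hβ : 0 ≤ β) (f : X₀) :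
    kFunctional X₀ X₁ α β (f : L0) ≤ α * ‖f‖ := by
  simpa using kFunctional_le (X₁ := X₁) hα hβ f 0 (by simp)

theorem kFunctional_le_right (hα : 0 ≤ α) (hβ : 0 ≤ β) (f : X₁) :
    kFunctional X₀ X₁ α β (f : L0) ≤ β * ‖f‖ := by
  simpa using kFunctional_le (X₀ := X₀) hα hβ 0 f (by simp)

theorem exists_of_kFunctional_lt {f : L0} (hf : f ∈ X₀.carrier ⊔ X₁.carrier) {r : ℝ}
    (h : kFunctional X₀ X₁ α β f < r) :
    ∃ (f₀ : X₀) (f₁ : X₁), f = (f₀ : L0) + (f₁ : L0) ∧ α * ‖f₀‖ + β * ‖f₁‖ < r := by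
  obtain ⟨a, ha, b, hb, rfl⟩ := Submodule.mem_sup.1 hf
  have hne : {r : ℝ | ∃ (f₀ : X₀) (f₁ : X₁), a + b = (f₀ : L0) + (f₁ : L0) ∧
      r = α * ‖f₀‖ + β * ‖f₁‖}.Nonempty := ⟨_, ⟨a, ha⟩, ⟨b, hb⟩, rfl, rfl⟩
  obtain ⟨_, ⟨f₀, f₁, h1, rfl⟩, h2⟩ := exists_lt_of_csInf_lt hne h
  exact ⟨f₀, f₁, h1, h2⟩

theorem kFunctional_add_le (hα : 0 ≤ α) (hβ : 0 ≤ β) {f g : L0}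
    (hf : f ∈ X₀.carrier ⊔ X₁.carrier) (hg : g ∈ X₀.carrier ⊔ X₁.carrier) :
    kFunctional X₀ X₁ α β (f + g) ≤ kFunctional X₀ X₁ α β f + kFunctional X₀ X₁ α β g := by
  refine le_of_forall_pos_lt_add fun ε hε => ?_
  obtain ⟨f₀, f₁, h1, h2⟩ := exists_of_kFunctional_lt hf
    (lt_add_of_pos_right (kFunctional X₀ X₁ α β f) (half_pos hε))
  obtain ⟨g₀, g₁, h3, h4⟩ := exists_of_kFunctional_lt hg
    (lt_add_of_pos_right (kFunctional X₀ X₁ α β g) (half_pos hε))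
  have := kFunctional_le hα hβ (f₀ + g₀) (f₁ + g₁) (f := f + g) (by
    rw [h1, h3]; push_cast; abel)
  have h5 := mul_le_mul_of_nonneg_left (norm_add_le f₀ g₀) hα
  have h6 := mul_le_mul_of_nonneg_left (norm_add_le f₁ g₁) hβ
  linarith

theorem kFunctional_mulLeft_le (hα : 0 ≤ α) (hβ : 0 ≤ β) {f h : L0}
    (hh : ∀ᵐ t, |h t| ≤ 1) (hf : f ∈ X₀.carrier ⊔ X₁.carrier) :
    kFunctional X₀ X₁ α β (L0.mulLeft h f) ≤ kFunctional X₀ X₁ α β f := by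
  refine le_of_forall_pos_lt_add fun ε hε => ?_
  obtain ⟨f₀, f₁, h1, h2⟩ := exists_of_kFunctional_lt hf
    (lt_add_of_pos_right (kFunctional X₀ X₁ α β f) hε)
  have := kFunctional_le hα hβ (X₀.mulOp h hh f₀) (X₁.mulOp h hh f₁) (f := L0.mulLeft h f) (by
    rw [h1, map_add]; rfl)
  have h5 := mul_le_mul_of_nonneg_left (X₀.norm_mulOp_le h hh f₀) hα
  have h6 := mul_le_mul_of_nonneg_left (X₁.norm_mulOp_le h hh f₁) hβ
  linarith

theorem mem_sup_of_abs_le {f g : L0} (hfg : |f| ≤ |g|) (hg : g ∈ X₀.carrier ⊔ X₁.carrier) :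
    f ∈ X₀.carrier ⊔ X₁.carrier := by
  obtain ⟨h, hh, rfl⟩ := L0.exists_mulLeft_eq hfg
  obtain ⟨a, ha, b, hb, rfl⟩ := Submodule.mem_sup.1 hg
  rw [map_add]
  exact Submodule.add_mem_sup (X₀.mulLeft_mem hh ha) (X₁.mulLeft_mem hh hb)

theorem kFunctional_mono (hα : 0 ≤ α) (hβ : 0 ≤ β) {f g : L0} (hfg : |f| ≤ |g|)
    (hg : g ∈ X₀.carrier ⊔ X₁.carrier) :
    kFunctional X₀ X₁ α β f ≤ kFunctional X₀ X₁ α β g := by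
  obtain ⟨h, hh, rfl⟩ := L0.exists_mulLeft_eq hfg
  exact kFunctional_mulLeft_le hα hβ hh hg

theorem kFunctional_smul_le (hα : 0 ≤ α) (hβ : 0 ≤ β) (c : ℝ) {f : L0}
    (hf : f ∈ X₀.carrier ⊔ X₁.carrier) :
    kFunctional X₀ X₁ α β (c • f) ≤ |c| * kFunctional X₀ X₁ α β f := by
  refine le_of_forall_pos_lt_add fun ε hε => ?_
  have hc : 0 < |c| + 1 := by positivity
  obtain ⟨f₀, f₁, h1, h2⟩ := exists_of_kFunctional_lt hf
    (lt_add_of_pos_right (kFunctional X₀ X₁ α β f) (div_pos hε hc))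
  have := kFunctional_le hα hβ (c • f₀) (c • f₁) (f := c • f) (by
    rw [h1, smul_add]; rfl)
  rw [norm_smul, norm_smul, Real.norm_eq_abs] at this
  have h3 := mul_le_mul_of_nonneg_left h2.le (abs_nonneg c)
  have h4 : |c| * (ε / (|c| + 1)) < ε := by
    rw [mul_div_assoc', div_lt_iff₀ hc]
    nlinarith
  linarith

theorem kFunctional_smul (hα : 0 ≤ α) (hβ : 0 ≤ β) (c : ℝ) {f : L0}
    (hf : f ∈ X₀.carrier ⊔ X₁.carrier) :
    kFunctional X₀ X₁ α β (c • f) = |c| * kFunctional X₀ X₁ α β f := by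
  refine le_antisymm (kFunctional_smul_le hα hβ c hf) ?_
  rcases eq_or_ne c 0 with rfl | hc
  · simpa using kFunctional_nonneg hα hβ _
  have h := kFunctional_smul_le hα hβ c⁻¹ (Submodule.smul_mem _ c hf)
  rw [inv_smul_smul₀ hc, abs_inv] at h
  rwa [← le_inv_mul_iff₀ (abs_pos.2 hc)]

end KFunctional

/-! ### Measure preserving maps of the unit interval. -/

namespace unitInterval

/-- The normalized distribution function of the Lebesgue measure on a subset of `[0,1]`. -/
def distrib (A : Set I) (t : I) : I :=
  ⟨(ProbabilityTheory.cond volume A).real (Set.Iic t),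
    measureReal_nonneg, by
      by_cases h : volume A = 0
      · simp [ProbabilityTheory.cond_eq_zero_of_meas_eq_zero h]
      · have := ProbabilityTheory.cond_isProbabilityMeasure (μ := volume) h
        exact measureReal_le_one⟩

theorem distrib_mono (A : Set I) : Monotone (distrib A) := fun s t hst => by
  refine Subtype.mk_le_mk.2 ?_
  have : IsFiniteMeasure (ProbabilityTheory.cond volume A) := by
    by_cases h : volume A = 0
    · rw [ProbabilityTheory.cond_eq_zero_of_meas_eq_zero h]
      infer_instance
    · have := ProbabilityTheory.cond_isProbabilityMeasure (μ := volume) h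
      infer_instance
  exact measureReal_mono (Set.Iic_subset_Iic.2 hst)

/-- The increment over `(s, t]` is at most `(t - s) / |A|`, so the function is Lipschitz. -/
theorem continuous_distrib {A : Set I} (h0 : volume A ≠ 0) :
    Continuous (distrib A) := by
  have := ProbabilityTheory.cond_isProbabilityMeasure (μ := volume) h0
  have key : ∀ s t : I, s ≤ t →
      dist (distrib A t) (distrib A s) ≤ (volume.real A)⁻¹ * dist t s := by
    intro s t hst
    have h1 : (distrib A t : ℝ) - distrib A s
        = (ProbabilityTheory.cond volume A).real (Set.Ioc s t) := by
      rw [← Set.Iic_sdiff_Iic, measureReal_sdiff (Set.Iic_subset_Iic.2 hst) measurableSet_Iic]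
      rfl
    rw [Subtype.dist_eq, Real.dist_eq, h1, abs_of_nonneg measureReal_nonneg, Subtype.dist_eq,
      Real.dist_eq, abs_of_nonneg (sub_nonneg.2 (Subtype.coe_le_coe.2 hst))]
    rw [measureReal_def, ProbabilityTheory.cond, Measure.smul_apply, smul_eq_mul, ENNReal.toReal_mul,
      ENNReal.toReal_inv]
    refine mul_le_mul_of_nonneg_left ?_ (by positivity)
    have h2 := Measure.restrict_apply_le (μ := (volume : Measure I)) A (Set.Ioc s t)
    rw [volume_Ioc] at h2
    exact (ENNReal.toReal_mono ENNReal.ofReal_ne_top h2).trans_eq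
      (ENNReal.toReal_ofReal (sub_nonneg.2 (Subtype.coe_le_coe.2 hst)))
  have hL : LipschitzWith (Real.toNNReal (volume.real A)⁻¹) (distrib A) := by
    refine LipschitzWith.of_dist_le_mul fun t s => ?_
    rw [Real.coe_toNNReal _ (by positivity)]
    rcases le_total s t with h | h
    · exact key s t h
    · rw [dist_comm, dist_comm t]
      exact key t s h
  exact hL.continuous

/-- Probability integral transform: the preimage of `[0, s]` is an interval `[0, T]`, and continuity
forces the distribution function to equal `s` at `T`. -/
theorem map_distrib {A : Set I} (h0 : volume A ≠ 0) :
    (ProbabilityTheory.cond volume A).map (distrib A) = volume := by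
  have := ProbabilityTheory.cond_isProbabilityMeasure (μ := volume) h0
  have hc := continuous_distrib h0
  have hF0 : distrib A 0 = 0 := by
    apply Subtype.ext
    have : Set.Iic (0 : I) = {0} := by ext x; simp
    change (ProbabilityTheory.cond volume A).real (Set.Iic (0 : I)) = 0
    have h3 : (ProbabilityTheory.cond volume A) {(0 : I)} = 0 :=
      ProbabilityTheory.cond_absolutelyContinuous (measure_singleton _)
    rw [this, measureReal_def, h3]
    simp
  have hF1 : distrib A 1 = 1 := by
    apply Subtype.ext
    have : Set.Iic (1 : I) = Set.univ := by ext x; simpa using Subtype.coe_le_coe.1 x.2.2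
    change (ProbabilityTheory.cond volume A).real (Set.Iic (1 : I)) = 1
    rw [this, measureReal_def, measure_univ]
    simp
  have := Measure.isProbabilityMeasure_map (μ := ProbabilityTheory.cond volume A) hc.aemeasurable
  refine Measure.ext_of_Iic _ _ fun s => ?_
  rw [Measure.map_apply hc.measurable measurableSet_Iic]
  obtain ⟨t₀, -, ht₀⟩ : s ∈ distrib A '' Set.Icc 0 1 :=
    intermediate_value_Icc zero_le_one hc.continuousOn ⟨by rw [hF0]; exact s.2.1, by
      rw [hF1]; exact s.2.2⟩
  have hclosed : IsClosed (distrib A ⁻¹' Set.Iic s) := isClosed_Iic.preimage hc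
  have hne : (distrib A ⁻¹' Set.Iic s).Nonempty := ⟨t₀, ht₀.le⟩
  set T := sSup (distrib A ⁻¹' Set.Iic s) with hT
  have hTm : T ∈ distrib A ⁻¹' Set.Iic s := hclosed.csSup_mem hne (OrderTop.bddAbove _)
  have hset : distrib A ⁻¹' Set.Iic s = Set.Iic T := by
    ext t
    exact ⟨fun ht => le_csSup (OrderTop.bddAbove _) ht, fun ht => (distrib_mono A ht).trans hTm⟩
  have hTs : distrib A T = s :=
    le_antisymm hTm (ht₀ ▸ distrib_mono A (le_csSup (OrderTop.bddAbove _) ht₀.le))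
  rw [hset, volume_Iic, ← hTs]
  exact (ofReal_measureReal (measure_ne_top _ _)).symm

/-- The distribution function of `A` carries normalized measure on `A` to Lebesgue measure, which a
measurable map `q` then carries to normalized measure on `B`. -/
theorem exists_map_restrict_eq {A B : Set I} (h : volume A = volume B) :
    ∃ τ : I → I, Measurable τ ∧
      (volume.restrict A).map τ = volume.restrict B := by
  by_cases h0 : volume A = 0
  · refine ⟨id, measurable_id, ?_⟩
    rw [Measure.map_id, Measure.restrict_eq_zero.2 h0, Measure.restrict_eq_zero.2 (h ▸ h0)]
  have h0' : volume B ≠ 0 := h ▸ h0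
  have := ProbabilityTheory.cond_isProbabilityMeasure (μ := volume) h0'
  obtain ⟨q, hq, hqB⟩ := Measure.exists_measurable_map_eq (ProbabilityTheory.cond volume B)
  have hF := (continuous_distrib h0).measurable
  refine ⟨q ∘ distrib A, hq.comp hF, ?_⟩
  have h1 : ∀ C : Set I, volume C ≠ 0 →
      volume.restrict C = volume C • ProbabilityTheory.cond volume C := fun C hC => by
    rw [ProbabilityTheory.cond, smul_smul, ENNReal.mul_inv_cancel hC (measure_ne_top _ _), one_smul]
  rw [h1 A h0, h1 B h0', Measure.map_smul, ← Measure.map_map hq hF, map_distrib h0, hqB, h]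

/-- Maps transporting each fibre of `u` to the corresponding fibre of `v` are glued along the
countable partition into fibres. -/
theorem exists_measurePreserving_comp_ae_eq {u v : I → ℕ} (hu : Measurable u) (hv : Measurable v)
    (h : ∀ k, volume (u ⁻¹' {k}) = volume (v ⁻¹' {k})) :
    ∃ τ : I → I, MeasurePreserving τ ∧ ∀ᵐ t, v (τ t) = u t := by
  choose τ hτ hmap using fun k => exists_map_restrict_eq (h k)
  have hU : ∀ k, MeasurableSet (u ⁻¹' {k}) := fun k => hu (measurableSet_singleton k)
  have hV : ∀ k, MeasurableSet (v ⁻¹' {k}) := fun k => hv (measurableSet_singleton k)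
  have hm : Measurable fun t => τ (u t) t := by
    have : Measurable fun p : ℕ × I => τ p.1 p.2 := measurable_from_prod_countable_right hτ
    exact this.comp (hu.prodMk measurable_id)
  have hdisj : ∀ w : I → ℕ, Pairwise (Function.onFun Disjoint fun k => w ⁻¹' {k}) :=
    fun w i j hij => Disjoint.preimage _ (by simpa using hij)
  have huniv : ∀ w : I → ℕ, ⋃ k, w ⁻¹' {k} = Set.univ := fun w => by
    ext t; simp
  have hsum : ∀ (w : I → ℕ), Measurable w → ∀ s : Set I, MeasurableSet s →
      volume s = ∑' k, volume.restrict (w ⁻¹' {k}) s := fun w hw s hs => by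
    rw [← Measure.restrict_univ (μ := volume), ← huniv w, Measure.restrict_iUnion_apply (hdisj w)
      (fun k => hw (measurableSet_singleton k)) hs]
    simp [huniv]
  have hpre : ∀ k (s : Set I), MeasurableSet s →
      volume.restrict (u ⁻¹' {k}) ((fun t => τ (u t) t) ⁻¹' s) = volume.restrict (v ⁻¹' {k}) s :=
    fun k s hs => by
      rw [← hmap k, Measure.map_apply (hτ k) hs, Measure.restrict_apply' (hU k),
        Measure.restrict_apply' (hU k)]
      congr 1
      ext t
      simp only [Set.mem_inter_iff, Set.mem_preimage, Set.mem_singleton_iff]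
      constructor <;> (rintro ⟨h1, rfl⟩; exact ⟨h1, rfl⟩)
  refine ⟨fun t => τ (u t) t, ⟨hm, ?_⟩, ?_⟩
  · ext s hs
    rw [Measure.map_apply hm hs, hsum u hu _ (hm hs), hsum v hv s hs]
    exact tsum_congr fun k => hpre k s hs
  · rw [ae_iff]
    have hs : MeasurableSet {t | ¬ v (τ (u t) t) = u t} :=
      (measurableSet_eq_fun (hv.comp hm) hu).compl
    rw [hsum u hu _ hs, ENNReal.tsum_eq_zero]
    intro k
    have : volume.restrict (u ⁻¹' {k}) {t | ¬ v (τ (u t) t) = u t} =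
        volume.restrict (u ⁻¹' {k}) ((fun t => τ (u t) t) ⁻¹' (v ⁻¹' {k})ᶜ) := by
      rw [Measure.restrict_apply' (hU k), Measure.restrict_apply' (hU k)]
      congr 1
      ext t
      simp only [Set.mem_inter_iff, Set.mem_preimage, Set.mem_singleton_iff, Set.mem_ofPred_eq,
        Set.mem_compl_iff]
      constructor <;> (rintro ⟨h1, rfl⟩; exact ⟨h1, rfl⟩)
    rw [this, hpre k _ (hV k).compl, Measure.restrict_apply' (hV k)]
    simp

end unitInterval

/-! ### Rearrangement invariance of the K-functional. -/

theorem Equimeasurable.symm {f g : L0} (h : Equimeasurable f g) : Equimeasurable g f :=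
  fun τ hτ => (h τ hτ).symm

theorem equimeasurable_compMeasurePreserving (f : L0) {τ : I → I} (hτ : MeasurePreserving τ) :
    Equimeasurable (f.compMeasurePreserving τ hτ) f := fun s _ => by
  have hs : MeasurableSet {t : I | s < |f t|} := measurableSet_lt measurable_const f.measurable.abs
  rw [← hτ.measure_preimage hs.nullMeasurableSet]
  refine measure_congr ?_
  filter_upwards [AEEqFun.coeFn_compMeasurePreserving f hτ] with t h
  change (s < |f.compMeasurePreserving τ hτ t|) = (s < |f (τ t)|)
  rw [h]; rfl

theorem L0.add_compMeasurePreserving (f g : L0) {τ : I → I} (hτ : MeasurePreserving τ) :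
    (f + g).compMeasurePreserving τ hτ
      = f.compMeasurePreserving τ hτ + g.compMeasurePreserving τ hτ := by
  apply AEEqFun.ext
  filter_upwards [AEEqFun.coeFn_compMeasurePreserving f hτ,
    AEEqFun.coeFn_compMeasurePreserving g hτ, AEEqFun.coeFn_compMeasurePreserving (f + g) hτ,
    AEEqFun.coeFn_add (f.compMeasurePreserving τ hτ) (g.compMeasurePreserving τ hτ),
    hτ.quasiMeasurePreserving.ae (AEEqFun.coeFn_add f g)] with t h1 h2 h3 h4 h5
  rw [h3, h4, Pi.add_apply, h1, h2, Function.comp_apply, h5]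
  rfl

/-- An exact `|f| = |g ∘ τ|` is not needed. Rounding to multiples of `ε` leaves countably many
levels of equal measure, which can be matched; the rounding costs `ε`. -/
theorem Equimeasurable.exists_measurePreserving {f g : L0} (h : Equimeasurable f g) {ε : ℝ}
    (hε : 0 < ε) :
    ∃ (τ : I → I) (_ : MeasurePreserving τ), ∀ᵐ t, |f t| ≤ |g (τ t)| + ε := by
  -- Truncated subtraction puts the values in `[0, ε]` at level `0`. Thus `lev > k` means `|f| > (k
  -- + 1) ε`, a strict inequality at a positive threshold, as `Equimeasurable` compares.
  let lev : L0 → I → ℕ := fun f t => ⌈|f t| / ε⌉₊ - 1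
  have hmeas : ∀ f : L0, Measurable (lev f) := fun f => by
    have h1 : Measurable fun t => ⌈|f t| / ε⌉₊ :=
      Nat.measurable_ceil.comp (f.measurable.abs.div_const ε)
    exact (measurable_of_countable fun n : ℕ => n - 1).comp h1
  have hlt : ∀ (f : L0) (k : ℕ), {t | k < lev f t} = {t | ((k + 1 : ℕ) : ℝ) * ε < |f t|} :=
    fun f k => by
      ext t
      simp only [Set.mem_ofPred_eq, lev]
      rw [lt_tsub_iff_right, Nat.lt_ceil, lt_div_iff₀ hε]
  have hvol : ∀ k : ℕ, volume {t | k < lev f t} = volume {t | k < lev g t} := fun k => by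
    rw [hlt, hlt]
    exact h _ (by positivity)
  have hm : ∀ (f : L0) (k : ℕ), MeasurableSet {t | k < lev f t} := fun f k =>
    measurableSet_lt measurable_const (hmeas f)
  obtain ⟨τ, hτ, hτ'⟩ := unitInterval.exists_measurePreserving_comp_ae_eq (hmeas f) (hmeas g)
    (fun k => by
      rcases k with - | k
      · have : ∀ f : L0, lev f ⁻¹' {0} = {t | 0 < lev f t}ᶜ := fun f => by ext t; simp
        rw [this, this, measure_compl (hm f 0) (measure_ne_top _ _),
          measure_compl (hm g 0) (measure_ne_top _ _), hvol]
      · have : ∀ f : L0, lev f ⁻¹' {k + 1} = {t | k < lev f t} \ {t | k + 1 < lev f t} :=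
          fun f => by
            ext t
            simp only [Set.mem_preimage, Set.mem_singleton_iff, Set.mem_sdiff, Set.mem_ofPred_eq]
            lia
        have hsub : ∀ f : L0, {t | k + 1 < lev f t} ⊆ {t | k < lev f t} := fun f t ht =>
          (Nat.lt_succ_self k).trans ht
        rw [this, this, measure_sdiff (hsub f) (hm f _).nullMeasurableSet (measure_ne_top _ _),
          measure_sdiff (hsub g) (hm g _).nullMeasurableSet (measure_ne_top _ _), hvol, hvol])
  refine ⟨τ, hτ, ?_⟩
  filter_upwards [hτ'] with t ht
  have h1 : |f t| ≤ (lev f t + 1) * ε := by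
    rw [← div_le_iff₀ hε]
    refine (Nat.le_ceil _).trans ?_
    have : ⌈|f t| / ε⌉₊ ≤ lev f t + 1 := by simp only [lev]; lia
    exact_mod_cast this
  have h2 : (lev g (τ t) : ℝ) * ε ≤ |g (τ t)| := by
    rcases Nat.eq_zero_or_pos (lev g (τ t)) with h0 | h0
    · rw [h0]; simp
    · rw [← le_div_iff₀ hε]
      have : lev g (τ t) < ⌈|g (τ t)| / ε⌉₊ := by
        simp only [lev] at h0 ⊢
        lia
      exact (Nat.lt_ceil.1 this).le
  rw [ht] at h2
  linarith

section KFunctional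

variable {X₀ X₁ : RISpace} {α β : ℝ}

theorem RISpace.compMeasurePreserving_mem (X : RISpace) {f : L0} (hf : f ∈ X.carrier) {τ : I → I}
    (hτ : MeasurePreserving τ) : f.compMeasurePreserving τ hτ ∈ X.carrier :=
  X.rearrange _ f (equimeasurable_compMeasurePreserving f hτ) hf

theorem RISpace.norm_compMeasurePreserving (X : RISpace) (f : X) {τ : I → I}
    (hτ : MeasurePreserving τ) :
    ‖(⟨(f : L0).compMeasurePreserving τ hτ, X.compMeasurePreserving_mem f.2 hτ⟩ : X)‖ = ‖f‖ :=
  X.nrm_rearrange ⟨_, X.compMeasurePreserving_mem f.2 hτ⟩ f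
    (equimeasurable_compMeasurePreserving _ hτ)

theorem compMeasurePreserving_mem_sup {f : L0} (hf : f ∈ X₀.carrier ⊔ X₁.carrier) {τ : I → I}
    (hτ : MeasurePreserving τ) :
    f.compMeasurePreserving τ hτ ∈ X₀.carrier ⊔ X₁.carrier := by
  obtain ⟨a, ha, b, hb, rfl⟩ := Submodule.mem_sup.1 hf
  rw [L0.add_compMeasurePreserving]
  exact Submodule.add_mem_sup (X₀.compMeasurePreserving_mem ha hτ)
    (X₁.compMeasurePreserving_mem hb hτ)

theorem kFunctional_compMeasurePreserving_le (hα : 0 ≤ α) (hβ : 0 ≤ β) {f : L0}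
    (hf : f ∈ X₀.carrier ⊔ X₁.carrier) {τ : I → I} (hτ : MeasurePreserving τ) :
    kFunctional X₀ X₁ α β (f.compMeasurePreserving τ hτ) ≤ kFunctional X₀ X₁ α β f := by
  refine le_of_forall_pos_lt_add fun ε hε => ?_
  obtain ⟨f₀, f₁, h1, h2⟩ := exists_of_kFunctional_lt hf
    (lt_add_of_pos_right (kFunctional X₀ X₁ α β f) hε)
  have := kFunctional_le hα hβ ⟨_, X₀.compMeasurePreserving_mem f₀.2 hτ⟩
    ⟨_, X₁.compMeasurePreserving_mem f₁.2 hτ⟩ (f := f.compMeasurePreserving τ hτ) (by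
      rw [h1, L0.add_compMeasurePreserving])
  rw [X₀.norm_compMeasurePreserving, X₁.norm_compMeasurePreserving] at this
  linarith

theorem Equimeasurable.abs_le {f g : L0} (h : Equimeasurable f g) {ε : ℝ} (hε : 0 < ε) :
    ∃ (τ : I → I) (hτ : MeasurePreserving τ),
      |f| ≤ |(|g.compMeasurePreserving τ hτ| + ε • (1 : L0))| := by
  obtain ⟨τ, hτ, hle⟩ := h.exists_measurePreserving hε
  refine ⟨τ, hτ, ?_⟩
  rw [L0.abs_le_abs_iff]
  filter_upwards [hle, AEEqFun.coeFn_compMeasurePreserving g hτ,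
    AEEqFun.coeFn_abs (g.compMeasurePreserving τ hτ),
    AEEqFun.coeFn_add |g.compMeasurePreserving τ hτ| (ε • (1 : L0)),
    AEEqFun.coeFn_smul ε (1 : L0), (AEEqFun.coeFn_one : ⇑(1 : L0) =ᵐ[volume] 1)]
    with t h1 h2 h3 h4 h5 h6
  rw [h4, Pi.add_apply, h3, h5, Pi.smul_apply, h6, h2]
  simp only [Function.comp_apply, Pi.one_apply, smul_eq_mul, mul_one]
  exact h1.trans (le_abs_self _)

theorem Equimeasurable.mem_sup {f g : L0} (h : Equimeasurable f g)
    (hone : (1 : L0) ∈ X₀.carrier) (hg : g ∈ X₀.carrier ⊔ X₁.carrier) :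
    f ∈ X₀.carrier ⊔ X₁.carrier := by
  obtain ⟨τ, hτ, hle⟩ := h.abs_le one_pos
  refine mem_sup_of_abs_le hle (Submodule.add_mem _ ?_
    (Submodule.smul_mem _ _ (Submodule.mem_sup_left hone)))
  exact mem_sup_of_abs_le (L0.abs_abs_eq _).le (compMeasurePreserving_mem_sup hg hτ)

/-- The additive error contributes `ε` times the K-functional of the constant `1`, which is
arbitrarily small; composing `g` with a measure preserving map transports its decompositions without
changing norms. -/
theorem Equimeasurable.kFunctional_le {f g : L0} (h : Equimeasurable f g)
    (hone : (1 : L0) ∈ X₀.carrier) (hα : 0 ≤ α) (hβ : 0 ≤ β) (hg : g ∈ X₀.carrier ⊔ X₁.carrier) :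
    kFunctional X₀ X₁ α β f ≤ kFunctional X₀ X₁ α β g := by
  have hone' : (1 : L0) ∈ X₀.carrier ⊔ X₁.carrier := Submodule.mem_sup_left hone
  refine le_of_forall_pos_le_add fun ε hε => ?_
  set C := kFunctional X₀ X₁ α β (1 : L0) with hC
  have hC0 : 0 ≤ C := kFunctional_nonneg hα hβ _
  have hδ : 0 < ε / (C + 1) := by positivity
  obtain ⟨τ, hτ, hle⟩ := h.abs_le hδ
  have hm := compMeasurePreserving_mem_sup hg hτ
  have hm' := mem_sup_of_abs_le (L0.abs_abs_eq _).le hm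
  have h1 := kFunctional_mono hα hβ hle
    (Submodule.add_mem _ hm' (Submodule.smul_mem _ _ hone'))
  have h2 := kFunctional_add_le hα hβ hm' (Submodule.smul_mem _ (ε / (C + 1)) hone')
  rw [kFunctional_smul hα hβ _ hone', abs_of_pos hδ, ← hC] at h2
  have h3 := kFunctional_mono hα hβ (L0.abs_abs_eq (g.compMeasurePreserving τ hτ)).le hm
  have h4 := kFunctional_compMeasurePreserving_le hα hβ hg hτ
  have h5 : ε / (C + 1) * C ≤ ε := by
    rw [div_mul_eq_mul_div, div_le_iff₀ (by positivity)]
    nlinarith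
  linarith

theorem Equimeasurable.kFunctional_eq {f g : L0} (h : Equimeasurable f g)
    (hone : (1 : L0) ∈ X₀.carrier) (hα : 0 ≤ α) (hβ : 0 ≤ β) (hg : g ∈ X₀.carrier ⊔ X₁.carrier) :
    kFunctional X₀ X₁ α β f = kFunctional X₀ X₁ α β g :=
  (h.kFunctional_le hone hα hβ hg).antisymm
    (h.symm.kFunctional_le hone hα hβ (h.mem_sup hone hg))

end KFunctional

/-! ### Expansions in a 1-unconditional basis. -/

section Sequence

variable {E : Type*} [NormedAddCommGroup E] [NormedSpace ℝ E] {e : SchauderBasis ℝ E}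

/-- Conditional convergence of the series with coefficients `a` along the basis. -/
def Expandable (e : SchauderBasis ℝ E) (a : ℕ → ℝ) : Prop :=
  Summable (fun n => a n • e n) (SummationFilter.conditional ℕ)

/-- The sum of the series with coefficients `a` along the basis. -/
def synth (e : SchauderBasis ℝ E) (a : ℕ → ℝ) : E :=
  ∑'[SummationFilter.conditional ℕ] n, a n • e n

omit [NormedSpace ℝ E] in
theorem hasSum_conditional_iff {f : ℕ → E} {x : E} :
    HasSum f x (SummationFilter.conditional ℕ) ↔
      Tendsto (fun n => ∑ i ∈ Finset.range n, f i) atTop (𝓝 x) := by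
  rw [HasSum, SummationFilter.conditional_filter_eq_map_range, tendsto_map'_iff]
  rfl

theorem Expandable.tendsto {a : ℕ → ℝ} (ha : Expandable e a) :
    Tendsto (fun n => ∑ i ∈ Finset.range n, a i • e i) atTop (𝓝 (synth e a)) :=
  hasSum_conditional_iff.1 (Summable.hasSum ha)

theorem coord_basis (e : SchauderBasis ℝ E) (i j : ℕ) :
    e.coord i (e j) = if i = j then 1 else 0 := by
  rw [e.ortho]
  by_cases h : i = j
  · subst h; simp
  · simp [h]

theorem coord_sum (e : SchauderBasis ℝ E) (s : Finset ℕ) (a : ℕ → ℝ) (n : ℕ) :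
    e.coord n (∑ i ∈ s, a i • e i) = if n ∈ s then a n else 0 := by
  rw [map_sum]
  simp [coord_basis]

theorem coord_synth {a : ℕ → ℝ} (ha : Expandable e a) (n : ℕ) : e.coord n (synth e a) = a n := by
  refine tendsto_nhds_unique (((e.coord n).continuous.tendsto _).comp ha.tendsto) ?_
  refine tendsto_const_nhds.congr' ?_
  filter_upwards [eventually_gt_atTop n] with N hN
  rw [Function.comp_apply, coord_sum, if_pos (Finset.mem_range.2 hN)]

theorem expandable_coord (e : SchauderBasis ℝ E) (x : E) : Expandable e fun n => e.coord n x :=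
  (e.expansion x).summable

theorem synth_coord (e : SchauderBasis ℝ E) (x : E) : synth e (fun n => e.coord n x) = x :=
  (e.expansion x).tsum_eq

theorem ext_coord {x y : E} (h : ∀ n, e.coord n x = e.coord n y) : x = y := by
  rw [← synth_coord e x, ← synth_coord e y]
  simp_rw [h]

theorem Expandable.add {a b : ℕ → ℝ} (ha : Expandable e a) (hb : Expandable e b) :
    Expandable e fun n => a n + b n := by
  unfold Expandable
  simp_rw [add_smul]
  exact Summable.add ha hb

theorem synth_add {a b : ℕ → ℝ} (ha : Expandable e a) (hb : Expandable e b) :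
    synth e (fun n => a n + b n) = synth e a + synth e b := by
  refine ext_coord (e := e) fun n => ?_
  rw [map_add, coord_synth ha, coord_synth hb, coord_synth (ha.add hb)]

theorem Expandable.const_mul {a : ℕ → ℝ} (ha : Expandable e a) (c : ℝ) :
    Expandable e fun n => c * a n := by
  unfold Expandable
  simp_rw [mul_smul]
  exact Summable.const_smul c ha

theorem synth_const_mul {a : ℕ → ℝ} (ha : Expandable e a) (c : ℝ) :
    synth e (fun n => c * a n) = c • synth e a := by
  refine ext_coord (e := e) fun n => ?_
  rw [map_smul, coord_synth ha, coord_synth (ha.const_mul c), smul_eq_mul]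

theorem synth_eq_zero_iff {a : ℕ → ℝ} (ha : Expandable e a) : synth e a = 0 ↔ a = 0 := by
  constructor
  · intro h
    funext n
    rw [← coord_synth ha n, h, map_zero, Pi.zero_apply]
  · rintro rfl
    simp [synth]

theorem expandable_finset (e : SchauderBasis ℝ E) (s : Finset ℕ) (a : ℕ → ℝ) :
    Expandable e fun n => if n ∈ s then a n else 0 := by
  have := expandable_coord e (∑ i ∈ s, a i • e i)
  simpa only [coord_sum] using this

namespace IsNormalizedOneUnconditional

variable (he : IsNormalizedOneUnconditional e)
include he

/-- With `a j = t * b j` and `|t| ≤ 1`, the vector for `a` is a convex combination of the vector for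
`b` and its reflection in the `j`-th coordinate. -/
theorem norm_sum_update_le (s : Finset ℕ) {a b : ℕ → ℝ} (j : ℕ) (hj : |a j| ≤ |b j|)
    (h : ∀ n, n ≠ j → a n = b n) : ‖∑ n ∈ s, a n • e n‖ ≤ ‖∑ n ∈ s, b n • e n‖ := by
  obtain ⟨t, ht, htj⟩ : ∃ t : ℝ, |t| ≤ 1 ∧ a j = t * b j := by
    by_cases hb : b j = 0
    · rw [hb, abs_zero] at hj
      exact ⟨0, by simp, by rw [abs_nonpos_iff.1 hj, zero_mul]⟩
    · refine ⟨a j / b j, ?_, (div_mul_cancel₀ _ hb).symm⟩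
      rw [abs_div]
      exact div_le_one_of_le₀ hj (abs_nonneg _)
  let θ : ℕ → ℝ := fun n => if n = j then -1 else 1
  have hθ := he.norm_signs s b θ (fun n => by by_cases hn : n = j <;> simp [θ, hn])
  have key : ∑ n ∈ s, a n • e n = ((1 + t) / 2) • ∑ n ∈ s, b n • e n
      + ((1 - t) / 2) • ∑ n ∈ s, (θ n * b n) • e n := by
    rw [Finset.smul_sum, Finset.smul_sum, ← Finset.sum_add_distrib]
    refine Finset.sum_congr rfl fun n _ => ?_
    rw [smul_smul, smul_smul, ← add_smul]
    congr 1
    by_cases hn : n = j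
    · subst hn
      rw [htj]
      simp only [θ, if_true]
      ring
    · rw [h n hn]
      simp only [θ, hn, if_false]
      ring
  obtain ⟨ht1, ht2⟩ := abs_le.1 ht
  rw [key]
  refine (norm_add_le _ _).trans ?_
  rw [norm_smul, norm_smul, hθ, Real.norm_of_nonneg (by linarith), Real.norm_of_nonneg (by linarith),
    ← add_mul]
  exact le_of_eq (by ring)

theorem norm_sum_le (s : Finset ℕ) {a b : ℕ → ℝ} (h : ∀ n ∈ s, |a n| ≤ |b n|) :
    ‖∑ n ∈ s, a n • e n‖ ≤ ‖∑ n ∈ s, b n • e n‖ := by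
  -- Coordinates are changed one at a time: induction on a finite set `u` off which `a` and `b`
  -- agree.
  have key : ∀ (u : Finset ℕ) (a b : ℕ → ℝ), (∀ n ∈ u, |a n| ≤ |b n|) → (∀ n, n ∉ u → a n = b n) →
      ‖∑ n ∈ s, a n • e n‖ ≤ ‖∑ n ∈ s, b n • e n‖ := by
    intro u
    induction u using Finset.induction_on with
    | empty =>
      intro a b _ h
      exact le_of_eq (by simp_rw [h _ (Finset.notMem_empty _)])
    | insert j u hj ih =>
      intro a b h1 h2
      refine (he.norm_sum_update_le s (b := Function.update a j (b j)) j ?_ ?_).trans (ih _ b ?_ ?_)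
      · rw [Function.update_self]
        exact h1 j (Finset.mem_insert_self _ _)
      · intro n hn
        rw [Function.update_of_ne hn]
      · intro n hn
        rw [Function.update_of_ne (fun h : n = j => hj (h ▸ hn))]
        exact h1 n (Finset.mem_insert_of_mem hn)
      · intro n hn
        by_cases hnj : n = j
        · rw [hnj, Function.update_self]
        · rw [Function.update_of_ne hnj]
          exact h2 n (by simp [hnj, hn])
  have := key s (fun n => if n ∈ s then a n else b n) b (fun n hn => by simpa [hn] using h n hn)
    (fun n hn => by simp [hn])
  refine le_of_eq_of_le ?_ this
  congr 1
  exact Finset.sum_congr rfl fun n hn => by simp [hn]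

theorem norm_sum_mono {s t : Finset ℕ} (hst : s ⊆ t) (a : ℕ → ℝ) :
    ‖∑ n ∈ s, a n • e n‖ ≤ ‖∑ n ∈ t, a n • e n‖ := by
  have := he.norm_sum_le t (a := fun n => if n ∈ s then a n else 0) (b := a) (fun n _ => by
    by_cases hn : n ∈ s <;> simp [hn])
  refine le_of_eq_of_le ?_ this
  simp_rw [ite_smul, zero_smul]
  rw [Finset.sum_ite_mem, Finset.inter_eq_right.2 hst]

theorem norm_sum_le_norm_synth {a : ℕ → ℝ} (ha : Expandable e a) (s : Finset ℕ) :
    ‖∑ n ∈ s, a n • e n‖ ≤ ‖synth e a‖ := by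
  refine ge_of_tendsto ha.tendsto.norm ?_
  obtain ⟨N, hN⟩ := s.exists_nat_subset_range
  filter_upwards [eventually_ge_atTop N] with M hM
  exact he.norm_sum_mono (hN.trans (Finset.range_mono hM)) a

theorem abs_le_norm_synth {a : ℕ → ℝ} (ha : Expandable e a) (n : ℕ) : |a n| ≤ ‖synth e a‖ := by
  simpa [norm_smul, he.norm_basis] using he.norm_sum_le_norm_synth ha {n}

theorem abs_le_norm_sum (s : Finset ℕ) (a : ℕ → ℝ) {n : ℕ} (hn : n ∈ s) :
    |a n| ≤ ‖∑ i ∈ s, a i • e i‖ := by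
  simpa [norm_smul, he.norm_basis] using he.norm_sum_mono (Finset.singleton_subset_iff.2 hn) a

omit he in
theorem norm_synth_le_of_sum_le {a : ℕ → ℝ} (ha : Expandable e a) {C : ℝ}
    (h : ∀ N, ‖∑ n ∈ Finset.range N, a n • e n‖ ≤ C) : ‖synth e a‖ ≤ C :=
  le_of_tendsto ha.tendsto.norm (Eventually.of_forall h)

theorem norm_synth_le {a b : ℕ → ℝ} (ha : Expandable e a) (hb : Expandable e b)
    (h : ∀ n, |a n| ≤ |b n|) : ‖synth e a‖ ≤ ‖synth e b‖ :=
  norm_synth_le_of_sum_le ha fun _ =>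
    (he.norm_sum_le _ fun n _ => h n).trans (he.norm_sum_le_norm_synth hb _)

/-- Cauchy partial sums control only intervals of indices; monotonicity in the index set extends the
bound to every finite set beyond `N`. -/
theorem exists_tail_le {a : ℕ → ℝ} (ha : Expandable e a) {ε : ℝ} (hε : 0 < ε) :
    ∃ N, ∀ s : Finset ℕ, (∀ n ∈ s, N ≤ n) → ‖∑ n ∈ s, a n • e n‖ < ε := by
  obtain ⟨N, hN⟩ := Metric.cauchySeq_iff'.1 ha.tendsto.cauchySeq ε hε
  refine ⟨N, fun s hs => ?_⟩
  obtain ⟨M, hM⟩ := s.exists_nat_subset_range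
  have hsub : s ⊆ Finset.Ico N (max N M) := fun n hn =>
    Finset.mem_Ico.2 ⟨hs n hn, (Finset.mem_range.1 (hM hn)).trans_le (le_max_right _ _)⟩
  refine (he.norm_sum_mono hsub a).trans_lt ?_
  rw [Finset.sum_Ico_eq_sub _ (le_max_left _ _), ← dist_eq_norm]
  exact hN _ (le_max_left _ _)

variable [CompleteSpace E]

omit he in
theorem expandable_of_tail_le {a : ℕ → ℝ}
    (h : ∀ ε > 0, ∃ N, ∀ M ≥ N, ‖∑ n ∈ Finset.Ico N M, a n • e n‖ < ε) : Expandable e a := by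
  have hc : CauchySeq fun n => ∑ i ∈ Finset.range n, a i • e i := by
    refine Metric.cauchySeq_iff'.2 fun ε hε => ?_
    obtain ⟨N, hN⟩ := h ε hε
    refine ⟨N, fun M hM => ?_⟩
    rw [dist_eq_norm, ← Finset.sum_Ico_eq_sub _ hM]
    exact hN M hM
  obtain ⟨x, hx⟩ := cauchySeq_tendsto_of_complete hc
  exact (hasSum_conditional_iff.2 hx).summable

theorem expandable_of_abs_le {a b : ℕ → ℝ} (hb : Expandable e b) (h : ∀ n, |a n| ≤ |b n|) :
    Expandable e a :=
  expandable_of_tail_le fun ε hε => by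
    obtain ⟨N, hN⟩ := he.exists_tail_le hb hε
    exact ⟨N, fun M hM => (he.norm_sum_le _ fun n _ => h n).trans_lt
      (hN _ fun n hn => (Finset.mem_Ico.1 hn).1)⟩

theorem expandable_of_summable {a : ℕ → ℝ} (h : Summable a) : Expandable e a := by
  have h1 : Summable fun n => a n • e n := by
    refine Summable.of_norm ?_
    simpa [norm_smul, he.norm_basis] using h.abs
  exact (hasSum_conditional_iff.2 h1.hasSum.tendsto_sum_nat).summable

omit [CompleteSpace E] in
/-- A bounded operator with prescribed values on the basis. -/
theorem exists_clm {V : Type*} [NormedAddCommGroup V] [NormedSpace ℝ V] [CompleteSpace V]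
    (g : ℕ → V) (C : ℝ)
    (h : ∀ (s : Finset ℕ) (c : ℕ → ℝ), ‖∑ n ∈ s, c n • g n‖ ≤ C * ‖∑ n ∈ s, c n • e n‖) :
    ∃ T : E →L[ℝ] V, ∀ n, T (e n) = g n := by
  have hC : 0 ≤ C := by
    have := (norm_nonneg _).trans (h {0} 1)
    simpa [he.norm_basis] using this
  have hconv : ∀ x : E, ∃ y, Tendsto (fun N => ∑ n ∈ Finset.range N, e.coord n x • g n) atTop
      (𝓝 y) := fun x => by
    refine cauchySeq_tendsto_of_complete (Metric.cauchySeq_iff'.2 fun ε hε => ?_)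
    obtain ⟨N, hN⟩ := he.exists_tail_le (expandable_coord e x)
      (show 0 < ε / (C + 1) by positivity)
    refine ⟨N, fun M hM => ?_⟩
    rw [dist_eq_norm, ← Finset.sum_Ico_eq_sub _ hM]
    refine (h _ _).trans_lt ?_
    have h1 := (hN (Finset.Ico N M) fun n hn => (Finset.mem_Ico.1 hn).1).le
    refine (mul_le_mul_of_nonneg_left h1 hC).trans_lt ?_
    rw [mul_div_assoc', div_lt_iff₀ (by positivity)]
    nlinarith
  choose T hT using hconv
  let L : E →ₗ[ℝ] V :=
    { toFun := T
      map_add' := fun x y => by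
        refine tendsto_nhds_unique (hT (x + y)) (((hT x).add (hT y)).congr fun N => ?_)
        rw [← Finset.sum_add_distrib]
        exact Finset.sum_congr rfl fun n _ => by rw [map_add, add_smul]
      map_smul' := fun c x => by
        refine tendsto_nhds_unique (hT (c • x)) (((hT x).const_smul c).congr fun N => ?_)
        rw [Finset.smul_sum]
        exact Finset.sum_congr rfl fun n _ => by rw [map_smul, smul_eq_mul, mul_smul] }
  refine ⟨L.mkContinuous C fun x => ?_, fun n => ?_⟩
  · refine le_of_tendsto (hT x).norm (Eventually.of_forall fun N => (h _ _).trans ?_)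
    refine mul_le_mul_of_nonneg_left ?_ hC
    have := he.norm_sum_le_norm_synth (expandable_coord e x) (Finset.range N)
    rwa [synth_coord] at this
  · refine tendsto_nhds_unique (hT (e n)) (tendsto_const_nhds.congr' ?_)
    filter_upwards [eventually_gt_atTop n] with N hN
    simp only [coord_basis, ite_smul, one_smul, zero_smul]
    rw [Finset.sum_ite_eq' _ n, if_pos (Finset.mem_range.2 hN)]

/-- A bounded operator with prescribed coordinates. -/
theorem exists_clm_coord {V : Type*} [NormedAddCommGroup V] [NormedSpace ℝ V]
    (y : ℕ → V →ₗ[ℝ] ℝ) (κ : V → ℕ → ℝ) (hκ : ∀ f, Expandable e (κ f))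
    (hκn : ∀ f, ‖synth e (κ f)‖ ≤ ‖f‖) (hy : ∀ n f, |y n f| ≤ κ f n) :
    ∃ Y : V →L[ℝ] E, ∀ n f, e.coord n (Y f) = y n f := by
  have hy' : ∀ f n, |y n f| ≤ |κ f n| := fun f n => (hy n f).trans (le_abs_self _)
  have hex : ∀ f, Expandable e fun n => y n f := fun f =>
    he.expandable_of_abs_le (hκ f) (hy' f)
  let L : V →ₗ[ℝ] E :=
    { toFun := fun f => synth e fun n => y n f
      map_add' := fun f g => ext_coord (e := e) fun n => by
        rw [map_add, coord_synth (hex _), coord_synth (hex _), coord_synth (hex _), map_add]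
      map_smul' := fun c f => ext_coord (e := e) fun n => by
        rw [map_smul, coord_synth (hex _), coord_synth (hex _), map_smul, RingHom.id_apply] }
  refine ⟨L.mkContinuous 1 fun f => ?_, fun n f => coord_synth (hex f) n⟩
  rw [one_mul]
  exact (he.norm_synth_le (hex f) (hκ f) (hy' f)).trans (hκn f)

section Lattice

variable [Lattice E] (horder : ∀ x y : E, x ≤ y ↔ ∀ n, e.coord n x ≤ e.coord n y)
include horder

/-- The lattice structure is known only through its order, so `|x|` is identified by its universal
property as a supremum; unconditionality makes the candidate expandable. -/
theorem coord_abs (x : E) (n : ℕ) : e.coord n |x| = |e.coord n x| := by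
  have hex : Expandable e fun n => |e.coord n x| :=
    he.expandable_of_abs_le (expandable_coord e x) fun n => (abs_abs _).le
  have : |x| = synth e fun n => |e.coord n x| := by
    refine le_antisymm (sup_le ?_ ?_) ?_
    · rw [horder]
      intro n
      rw [coord_synth hex]
      exact le_abs_self _
    · rw [horder]
      intro n
      rw [coord_synth hex, map_neg]
      exact neg_le_abs _
    · rw [horder]
      intro n
      rw [coord_synth hex]
      have h1 := (horder _ _).1 (le_sup_left : x ≤ x ⊔ -x) n
      have h2 := (horder _ _).1 (le_sup_right : -x ≤ x ⊔ -x) n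
      rw [map_neg] at h2
      exact abs_le'.2 ⟨h1, h2⟩
  rw [this, coord_synth hex]

theorem abs_inf_abs_eq_zero_iff (x y : E) :
    |x| ⊓ |y| = 0 ↔ ∀ n, e.coord n x = 0 ∨ e.coord n y = 0 := by
  have hmin : ∀ n, |min (|e.coord n x|) (|e.coord n y|)| ≤ |e.coord n x| := fun n => by
    rw [abs_of_nonneg (le_min (abs_nonneg _) (abs_nonneg _))]
    exact min_le_left _ _
  have hex : Expandable e fun n => min |e.coord n x| |e.coord n y| :=
    he.expandable_of_abs_le (expandable_coord e x) hmin
  have : |x| ⊓ |y| = synth e fun n => min |e.coord n x| |e.coord n y| := by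
    refine le_antisymm ?_ (le_inf ?_ ?_)
    · rw [horder]
      intro n
      rw [coord_synth hex, ← he.coord_abs horder, ← he.coord_abs horder]
      exact le_min ((horder _ _).1 inf_le_left n) ((horder _ _).1 inf_le_right n)
    · rw [horder]
      intro n
      rw [coord_synth hex, he.coord_abs horder]
      exact min_le_left _ _
    · rw [horder]
      intro n
      rw [coord_synth hex, he.coord_abs horder]
      exact min_le_right _ _
  rw [this, synth_eq_zero_iff hex, funext_iff]
  refine forall_congr' fun n => ?_
  constructor
  · intro h
    rcases min_choice |e.coord n x| |e.coord n y| with h' | h'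
    · left; rw [← abs_eq_zero, ← h']; exact h
    · right; rw [← abs_eq_zero, ← h']; exact h
  · rintro (h | h) <;> simp [h]

end Lattice

end IsNormalizedOneUnconditional

end Sequence

/-! ### Complemented sequences and norming functionals. -/

section Complemented

variable {V V' : Type*} [NormedAddCommGroup V] [NormedSpace ℝ V] [NormedAddCommGroup V']
  [NormedSpace ℝ V']

theorem exists_sum_range_of_mem_span {x : ℕ → V} {z : V} (hz : z ∈ Submodule.span ℝ (Set.range x)) :
    ∃ (c : ℕ → ℝ) (M : ℕ), z = ∑ j ∈ Finset.range M, c j • x j := by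
  obtain ⟨c, rfl⟩ := Finsupp.mem_span_range_iff_exists_finsupp.1 hz
  obtain ⟨M, hM⟩ := c.support.exists_nat_subset_range
  exact ⟨c, M, Finsupp.sum_of_support_subset _ hM _ fun _ _ => zero_smul _ _⟩

theorem isComplementedSeq_of_eq_zero {x : ℕ → V} (hx : ∀ n, x n = 0) : IsComplementedSeq x := by
  have h0 : Submodule.span ℝ (Set.range x) = ⊥ := by
    rw [Submodule.span_eq_bot]
    rintro _ ⟨n, rfl⟩
    exact hx n
  refine ⟨0, fun z => ?_⟩
  have hz := z.2
  have : z.1 ∈ closure ((⊥ : Submodule ℝ V) : Set V) := by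
    rw [← h0]; exact hz
  rw [Submodule.bot_coe, closure_singleton] at this
  exact Subtype.ext this.symm

theorem isComplementedSeq_smul_iff {x : ℕ → V} {c : ℕ → ℝ} (hc : ∀ n, c n ≠ 0) :
    IsComplementedSeq (fun n => c n • x n) ↔ IsComplementedSeq x := by
  have : Submodule.span ℝ (Set.range fun n => c n • x n) = Submodule.span ℝ (Set.range x) := by
    refine le_antisymm (Submodule.span_le.2 ?_) (Submodule.span_le.2 ?_)
    · rintro _ ⟨n, rfl⟩
      exact Submodule.smul_mem _ _ (Submodule.subset_span ⟨n, rfl⟩)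
    · rintro _ ⟨n, rfl⟩
      have h : c n • x n ∈ Submodule.span ℝ (Set.range fun n => c n • x n) :=
        Submodule.subset_span ⟨n, rfl⟩
      have := Submodule.smul_mem _ (c n)⁻¹ h
      rwa [inv_smul_smul₀ (hc n)] at this
  rw [IsComplementedSeq, this, IsComplementedSeq]

/-- Complementation of a sequence is inherited from its image under an operator which is bounded
below on the span of the sequence. -/
theorem IsComplementedSeq.of_map [CompleteSpace V] [CompleteSpace V'] {x : ℕ → V} (Y : V →L[ℝ] V') (C : ℝ)
    (hC : ∀ z ∈ Submodule.span ℝ (Set.range x), ‖z‖ ≤ C * ‖Y z‖)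
    (h : IsComplementedSeq (Y ∘ x)) : IsComplementedSeq x := by
  set S := (Submodule.span ℝ (Set.range x)).topologicalClosure with hS
  set S' := (Submodule.span ℝ (Set.range (Y ∘ x))).topologicalClosure with hS'
  obtain ⟨Q, hQ⟩ : S'.ClosedComplemented := h
  have hSc : IsClosed (S : Set V) := Submodule.isClosed_topologicalClosure _
  have : CompleteSpace S := hSc.completeSpace_coe
  have hCS : ∀ z ∈ S, ‖z‖ ≤ C * ‖Y z‖ := by
    intro z hz
    have hcl : IsClosed {z : V | ‖z‖ ≤ C * ‖Y z‖} :=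
      isClosed_le continuous_norm (continuous_const.mul Y.continuous.norm)
    exact closure_minimal hC hcl hz
  let f : S →L[ℝ] V' := Y.comp S.subtypeL
  have hf : AntilipschitzWith (Real.toNNReal C) f := by
    refine AddMonoidHomClass.antilipschitz_of_bound f fun z => ?_
    refine (hCS z z.2).trans ?_
    exact mul_le_mul_of_nonneg_right (Real.le_coe_toNNReal C) (norm_nonneg _)
  -- Being bounded below on the complete space `S`, the operator has closed range; hence it has a
  -- bounded inverse there, and the range contains `S'`.
  have hcl : IsClosed (Set.range f) := hf.isClosed_range f.uniformContinuous
  let T := f.equivRange hf.injective hcl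
  have hle : S' ≤ f.range := by
    refine Submodule.topologicalClosure_minimal _ (Submodule.span_le.2 ?_) (by simpa using! hcl)
    rintro _ ⟨n, rfl⟩
    exact ⟨⟨x n, Submodule.le_topologicalClosure _ (Submodule.subset_span ⟨n, rfl⟩)⟩, rfl⟩
  have hYS : ∀ z ∈ S, Y z ∈ S' := by
    intro z hz
    have hcl' : IsClosed {z : V | Y z ∈ S'} :=
      (Submodule.isClosed_topologicalClosure _).preimage Y.continuous
    refine closure_minimal ?_ hcl' hz
    intro z hz
    have h1 : Y z ∈ (Submodule.span ℝ (Set.range x)).map (Y : V →ₗ[ℝ] V') := ⟨z, hz, rfl⟩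
    rw [Submodule.map_span, ← Set.range_comp] at h1
    exact Submodule.le_topologicalClosure _ h1
  let Q' : V' →L[ℝ] f.range :=
    (S'.subtypeL.comp Q).codRestrict f.range fun y => hle (Q y).2
  -- The projection is `Y`, then `Q`, then the inverse of `Y` on `S`; it fixes `S` because `Q` fixes
  -- `Y z`.
  refine ⟨(T.symm : f.range →L[ℝ] S).comp (Q'.comp Y), fun z => ?_⟩
  change T.symm (Q' (Y z)) = z
  rw [ContinuousLinearEquiv.symm_apply_eq]
  apply Subtype.ext
  have h1 := hQ ⟨Y z, hYS z z.2⟩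
  change (Q (Y z) : V') = Y z
  rw [h1]

/-- Hahn–Banach for the sublinear functional `p`, starting from `c • x ↦ c * p x` on the line
through `x`. -/
theorem Seminorm.exists_dual_vector (p : Seminorm ℝ V) (x : V) :
    ∃ φ : V →ₗ[ℝ] ℝ, φ x = p x ∧ ∀ z, |φ z| ≤ p z := by
  by_cases hx : x = 0
  · exact ⟨0, by simp [hx], fun z => by simp⟩
  obtain ⟨φ, h1, h2⟩ := exists_extension_of_le_sublinear
    (LinearPMap.mkSpanSingleton x (p x) hx) p
    (fun c hc z => by rw [map_smul_eq_mul, Real.norm_of_nonneg hc.le])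
    (fun z w => map_add_le_add p z w) (by
      rintro ⟨z, hz⟩
      obtain ⟨c, rfl⟩ := Submodule.mem_span_singleton.1 hz
      rw [LinearPMap.mkSpanSingleton'_apply, smul_eq_mul]
      refine (mul_le_mul_of_nonneg_right (le_abs_self c) (apply_nonneg p x)).trans_eq ?_
      exact (map_smul_eq_mul p c x).symm)
  refine ⟨φ, ?_, fun z => abs_le'.2 ⟨h2 z, ?_⟩⟩
  · have := h1 ⟨x, Submodule.mem_span_singleton_self x⟩
    rw [this]
    exact LinearPMap.mkSpanSingleton_apply ℝ ℝ hx (p x)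
  · rw [← map_neg, ← map_neg_eq_map p z]
    exact h2 _

end Complemented

/-! ### Consecutive blocks and the gliding hump. -/

section Blocks

/-- The number of the block `[p j, p (j + 1))` containing `k`. -/
def blockIndex (p : ℕ → ℕ) (hp : StrictMono p) (k : ℕ) : ℕ :=
  Nat.find (p := fun j => k < p (j + 1)) ⟨k, (Nat.lt_succ_self k).trans_le (hp.le_apply)⟩

theorem blockIndex_eq {p : ℕ → ℕ} (hp : StrictMono p) {j k : ℕ}
    (hk : k ∈ Finset.Ico (p j) (p (j + 1))) : blockIndex p hp k = j := by
  rw [Finset.mem_Ico] at hk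
  refine (Nat.find_eq_iff _).2 ⟨hk.2, fun i hi => ?_⟩
  exact not_lt.2 ((hp.monotone hi).trans hk.1)

theorem blockIndex_iff {p : ℕ → ℕ} (hp : StrictMono p) (hp0 : p 0 = 0) {j k : ℕ} :
    k ∈ Finset.Ico (p j) (p (j + 1)) ↔ blockIndex p hp k = j := by
  refine ⟨blockIndex_eq hp, fun h => ?_⟩
  subst h
  have h1 : k < p (blockIndex p hp k + 1) := Nat.find_spec (p := fun j => k < p (j + 1)) _
  refine Finset.mem_Ico.2 ⟨?_, h1⟩
  rcases Nat.eq_zero_or_pos (blockIndex p hp k) with h0 | h0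
  · rw [h0, hp0]
    exact Nat.zero_le _
  · have := Nat.find_min (p := fun j => k < p (j + 1)) _
      (show blockIndex p hp k - 1 < blockIndex p hp k by lia)
    rw [Nat.sub_add_cancel h0] at this
    exact not_lt.1 this

variable {E : Type*} [NormedAddCommGroup E] [NormedSpace ℝ E] {e : SchauderBasis ℝ E}

/-- Rewrites combinations of blocks as basis expansions, so that unconditionality applies to the
coefficients `c j`. -/
theorem sum_range_blocks {p : ℕ → ℕ} (hp : StrictMono p) (hp0 : p 0 = 0) (a c : ℕ → ℝ) (M : ℕ) :
    ∑ j ∈ Finset.range M, c j • ∑ k ∈ Finset.Ico (p j) (p (j + 1)), a k • e k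
      = ∑ k ∈ Finset.range (p M), (c (blockIndex p hp k) * a k) • e k := by
  induction M with
  | zero => simp [hp0]
  | succ M ih =>
    rw [Finset.sum_range_succ, ih, ← Finset.sum_range_add_sum_Ico _ (hp (Nat.lt_succ_self M)).le,
      Finset.smul_sum]
    congr 1
    refine Finset.sum_congr rfl fun k hk => ?_
    rw [blockIndex_eq hp hk, mul_smul]

variable (he : IsNormalizedOneUnconditional e)
include he

/-- Almost disjoint expandable sequences: a subsequence is concentrated on consecutive blocks. -/
theorem exists_blocks {a : ℕ → ℕ → ℝ} (ha : ∀ j, Expandable e (a j))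
    (hlim : ∀ n, Tendsto (fun j => a j n) atTop (𝓝 0)) {δ : ℕ → ℝ} (hδ : ∀ i, 0 < δ i) :
    ∃ ψ p : ℕ → ℕ, StrictMono ψ ∧ StrictMono p ∧ p 0 = 0 ∧
      (∀ i, ‖∑ n ∈ Finset.range (p i), a (ψ i) n • e n‖ < δ i) ∧
      ∀ i, ∀ s : Finset ℕ, (∀ n ∈ s, p (i + 1) ≤ n) → ‖∑ n ∈ s, a (ψ i) n • e n‖ < δ i := by
  -- A state is the last chosen sequence and the end of the last block: the next sequence is taken
  -- late enough to be small on the old range, then the range is enlarged until its tail is small.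
  have step : ∀ (i : ℕ) (q : ℕ × ℕ), ∃ q' : ℕ × ℕ, q.1 < q'.1 ∧ q.2 < q'.2 ∧
      ‖∑ n ∈ Finset.range q.2, a q'.1 n • e n‖ < δ i ∧
      ∀ s : Finset ℕ, (∀ n ∈ s, q'.2 ≤ n) → ‖∑ n ∈ s, a q'.1 n • e n‖ < δ i := by
    rintro i ⟨j, N⟩
    have h1 : Tendsto (fun j => ‖∑ n ∈ Finset.range N, a j n • e n‖) atTop (𝓝 0) := by
      have : Tendsto (fun j => ∑ n ∈ Finset.range N, a j n • e n) atTop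
          (𝓝 (∑ n ∈ Finset.range N, (0 : ℝ) • e n)) :=
        tendsto_finsetSum _ fun n _ => (hlim n).smul_const _
      simpa using this.norm
    obtain ⟨j', hj', hjj'⟩ := ((h1.eventually_lt_const (hδ i)).and (eventually_gt_atTop j)).exists
    obtain ⟨N', hN'⟩ := he.exists_tail_le (ha j') (hδ i)
    refine ⟨(j', max (N + 1) N'), hjj', (Nat.lt_succ_self N).trans_le (le_max_left _ _), hj', ?_⟩
    exact fun s hs => hN' s fun n hn => (le_max_right _ _).trans (hs n hn)
  choose F hF1 hF2 hF3 hF4 using step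
  -- Starting at `0` makes the blocks cover all of `ℕ`.
  let q : ℕ → ℕ × ℕ := fun i => Nat.rec (0, 0) F i
  exact ⟨fun i => (q (i + 1)).1, fun i => (q i).2, strictMono_nat_of_lt_succ fun i => hF1 _ _,
    strictMono_nat_of_lt_succ fun i => hF2 _ _, rfl, fun i => hF3 i (q i), fun i => hF4 i (q i)⟩

end Blocks

/-! ### Complemented subsequences from complemented blocks. -/

section Selection

variable {E : Type*} [NormedAddCommGroup E] [NormedSpace ℝ E] [CompleteSpace E]
  {e : SchauderBasis ℝ E}
  {V : Type*} [NormedAddCommGroup V] [NormedSpace ℝ V] [CompleteSpace V]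

/-- If the norm of `V` is the norm in `E` of a sequence of seminorms and blocks of the basis of `E`
have complemented subsequences, then so do normalized sequences in `V` which are disjoint with
respect to `D` and null for each of the seminorms. -/
theorem exists_isComplementedSeq_of_norm_eq_one (he : IsNormalizedOneUnconditional e)
    (hb : ∀ u : ℕ → E, IsBlockBasis e u → ∃ φ : ℕ → ℕ, StrictMono φ ∧ IsComplementedSeq (u ∘ φ))
    (κ : ℕ → Seminorm ℝ V) (hκ : ∀ f, Expandable e fun n => κ n f)
    (hκn : ∀ f, ‖synth e fun n => κ n f‖ = ‖f‖) (x : ℕ → V) (D : ℕ → V →ₗ[ℝ] V)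
    (hD : ∀ n j f, κ n (D j f) ≤ κ n f) (hDx : ∀ j, D j (x j) = x j)
    (hDx' : ∀ i j, i ≠ j → D j (x i) = 0) (hx : ∀ j, ‖x j‖ = 1)
    (hlim : ∀ n, Tendsto (fun j => κ n (x j)) atTop (𝓝 0)) :
    ∃ φ : ℕ → ℕ, StrictMono φ ∧ IsComplementedSeq (x ∘ φ) := by
  -- Head and tail together cost at most `2⁻ʲ / 4`. With `|c j| ≤ 2 A` below, the errors sum to at
  -- most `A`, whence the constant `2` in `hkey`.
  obtain ⟨ψ, p, hψ, hp, hp0, hhead, htail⟩ := exists_blocks he (a := fun j n => κ n (x j))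
    (fun j => hκ (x j)) hlim (δ := fun i => 1 / 8 * (1 / 2) ^ i) (fun i => by positivity)
  set idx := blockIndex p hp with hidx
  set a : ℕ → ℝ := fun k => κ k (x (ψ (idx k))) with ha
  set v : ℕ → E := fun j => ∑ k ∈ Finset.Ico (p j) (p (j + 1)), a k • e k with hv
  have hvj : ∀ j, v j = ∑ k ∈ Finset.Ico (p j) (p (j + 1)), κ k (x (ψ j)) • e k := fun j =>
    Finset.sum_congr rfl fun k hk => by simp only [ha, hidx]; rw [blockIndex_eq hp hk]
  have hδ : ∀ j, (1 : ℝ) / 8 * (1 / 2) ^ j ≤ 1 / 8 := fun j => by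
    have : ((1 : ℝ) / 2) ^ j ≤ 1 := pow_le_one₀ (by norm_num) (by norm_num)
    linarith
  -- splitting a partial sum into the head, the block and the tail
  have hsplit : ∀ j M, p (j + 1) ≤ M →
      ‖∑ n ∈ Finset.range M, κ n (x (ψ j)) • e n - v j‖ ≤ 2 * (1 / 8 * (1 / 2) ^ j) := by
    intro j M hM
    rw [← Finset.sum_range_add_sum_Ico _ hM,
      ← Finset.sum_range_add_sum_Ico _ (hp (Nat.lt_succ_self j)).le, ← hvj]
    have h1 := hhead j
    have h2 := htail j (Finset.Ico (p (j + 1)) M) fun n hn => (Finset.mem_Ico.1 hn).1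
    have h3 : ∀ u w z : E, u + w + z - w = u + z := fun u w z => by abel
    rw [h3]
    exact (norm_add_le _ _).trans (by linarith)
  have hvhalf : ∀ j, 1 / 2 ≤ ‖v j‖ := by
    intro j
    have : ‖synth e fun n => κ n (x (ψ j))‖ ≤ ‖v j‖ + 1 / 2 := by
      refine IsNormalizedOneUnconditional.norm_synth_le_of_sum_le (hκ _) fun N => ?_
      refine (he.norm_sum_mono (Finset.range_mono (le_max_left N (p (j + 1)))) _).trans ?_
      have h1 := hsplit j (max N (p (j + 1))) (le_max_right _ _)
      have h2 := norm_le_norm_add_norm_sub' (∑ n ∈ Finset.range (max N (p (j + 1))),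
        κ n (x (ψ j)) • e n) (v j)
      linarith [hδ j]
    rw [hκn, hx] at this
    linarith
  -- the estimate of combinations of `x` by combinations of blocks
  have hkey : ∀ (c : ℕ → ℝ) (M : ℕ), ‖∑ j ∈ Finset.range M, c j • x (ψ j)‖ ≤
      2 * ‖∑ j ∈ Finset.range M, c j • v j‖ := by
    intro c M
    -- Subadditivity of the seminorms only yields `|c j|`; unconditionality removes the absolute
    -- values.
    have habs : ‖∑ j ∈ Finset.range M, |c j| • v j‖ ≤ ‖∑ j ∈ Finset.range M, c j • v j‖ := by
      rw [sum_range_blocks hp hp0, sum_range_blocks hp hp0 a c]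
      refine he.norm_sum_le _ fun n _ => ?_
      rw [abs_mul, abs_mul, abs_abs]
    set A := ‖∑ j ∈ Finset.range M, c j • v j‖ with hA
    have hcj : ∀ j ∈ Finset.range M, |c j| ≤ 2 * A := by
      intro j hj
      have h1 : ‖c j • v j‖ ≤ A := by
        have h2 : c j • v j = ∑ k ∈ Finset.Ico (p j) (p (j + 1)), (c (idx k) * a k) • e k := by
          rw [hv, Finset.smul_sum]
          refine Finset.sum_congr rfl fun k hk => ?_
          simp only [hidx]
          rw [blockIndex_eq hp hk, mul_smul]
        rw [h2, hA, sum_range_blocks hp hp0]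
        refine he.norm_sum_mono (fun k hk => ?_) _
        exact Finset.mem_range.2 ((Finset.mem_Ico.1 hk).2.trans_le
          (hp.monotone (Finset.mem_range.1 hj)))
      rw [norm_smul, Real.norm_eq_abs] at h1
      nlinarith [abs_nonneg (c j), hvhalf j]
    rw [← hκn]
    refine IsNormalizedOneUnconditional.norm_synth_le_of_sum_le (hκ _) fun N => ?_
    refine (he.norm_sum_mono (Finset.range_mono (le_max_left N (p M))) _).trans ?_
    set K := max N (p M) with hK
    have h1 : ‖∑ n ∈ Finset.range K, κ n (∑ j ∈ Finset.range M, c j • x (ψ j)) • e n‖ ≤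
        ‖∑ n ∈ Finset.range K, (∑ j ∈ Finset.range M, |c j| * κ n (x (ψ j))) • e n‖ := by
      refine he.norm_sum_le _ fun n _ => abs_le_abs_of_nonneg (apply_nonneg _ _) ?_
      refine (Finset.le_sum_of_subadditive (κ n) (map_zero (κ n)).le (map_add_le_add (κ n)) _ _).trans_eq ?_
      exact Finset.sum_congr rfl fun j _ => map_smul_eq_mul (κ n) _ _
    have h2 : ∑ n ∈ Finset.range K, (∑ j ∈ Finset.range M, |c j| * κ n (x (ψ j))) • e n
        = ∑ j ∈ Finset.range M, |c j| • v j + ∑ j ∈ Finset.range M,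
          |c j| • (∑ n ∈ Finset.range K, κ n (x (ψ j)) • e n - v j) := by
      rw [← Finset.sum_add_distrib]
      simp_rw [← smul_add, add_sub_cancel, Finset.sum_smul, Finset.smul_sum, mul_smul]
      exact Finset.sum_comm
    have h3 : ‖∑ j ∈ Finset.range M,
          |c j| • (∑ n ∈ Finset.range K, κ n (x (ψ j)) • e n - v j)‖ ≤ A := by
      refine (norm_sum_le _ _).trans ?_
      have h4 : ∀ j ∈ Finset.range M,
          ‖|c j| • (∑ n ∈ Finset.range K, κ n (x (ψ j)) • e n - v j)‖ ≤
            A / 2 * (1 / 2) ^ j := by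
        intro j hj
        rw [norm_smul, Real.norm_eq_abs, abs_abs]
        have h5 := hsplit j K ((hp.monotone (Finset.mem_range.1 hj)).trans (le_max_right _ _))
        refine (mul_le_mul (hcj j hj) h5 (norm_nonneg _)
          ((abs_nonneg _).trans (hcj j hj))).trans_eq (by ring)
      refine (Finset.sum_le_sum h4).trans ?_
      rw [← Finset.mul_sum]
      have h6 : ∑ j ∈ Finset.range M, ((1 : ℝ) / 2) ^ j ≤ 2 := by
        refine le_of_le_of_eq ?_ tsum_geometric_two
        exact summable_geometric_two.sum_le_tsum _ fun _ _ => by positivity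
      have h7 : 0 ≤ A / 2 := by positivity
      nlinarith
    refine h1.trans ?_
    rw [h2]
    refine (norm_add_le _ _).trans ?_
    linarith
  -- the operator with values in `E`
  choose φ hφ1 hφ2 using fun n => (κ n).exists_dual_vector (x (ψ (idx n)))
  -- The functional `φ n` is evaluated after `D`, which fixes the term of the block containing `n`
  -- and kills all others, so `Y` sends the `j`-th term exactly to `v j`.
  obtain ⟨Y, hY⟩ := he.exists_clm_coord (fun n => (φ n).comp (D (ψ (idx n))))
    (fun f n => κ n f) hκ (fun f => (hκn f).le)
    (fun n f => (hφ2 n _).trans (hD n _ f))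
  have hYx : ∀ j, Y (x (ψ j)) = v j := fun j => by
    refine ext_coord (e := e) fun n => ?_
    rw [hY, hv, coord_sum, LinearMap.comp_apply]
    by_cases hn : n ∈ Finset.Ico (p j) (p (j + 1))
    · have hj : idx n = j := blockIndex_eq hp hn
      rw [if_pos hn, ha, ← hj, hDx]
      exact hφ1 n
    · rw [if_neg hn, hDx', map_zero]
      intro h
      exact hn ((blockIndex_iff hp hp0).2 (hψ.injective h).symm)
  obtain ⟨χ, hχ, hc⟩ := hb v ⟨p, a, hp, fun j => ⟨rfl, fun h0 => by
    have := hvhalf j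
    rw [h0, norm_zero] at this
    norm_num at this⟩⟩
  refine ⟨ψ ∘ χ, hψ.comp hχ, IsComplementedSeq.of_map Y 2 (fun z hz => ?_) ?_⟩
  · have hz' : z ∈ Submodule.span ℝ (Set.range (x ∘ ψ)) := by
      refine Submodule.span_mono ?_ hz
      rintro _ ⟨n, rfl⟩
      exact ⟨χ n, rfl⟩
    obtain ⟨c, M, rfl⟩ := exists_sum_range_of_mem_span hz'
    refine (hkey c M).trans_eq ?_
    rw [map_sum]
    simp_rw [map_smul, Function.comp_apply, hYx]
  · convert hc using 1
    funext n
    exact hYx _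

/-- Infinitely many zero terms give the trivial span; otherwise a subsequence of nonzero terms can
be normalized without changing spans. -/
theorem exists_isComplementedSeq (he : IsNormalizedOneUnconditional e)
    (hb : ∀ u : ℕ → E, IsBlockBasis e u → ∃ φ : ℕ → ℕ, StrictMono φ ∧ IsComplementedSeq (u ∘ φ))
    (κ : ℕ → Seminorm ℝ V) (hκ : ∀ f, Expandable e fun n => κ n f)
    (hκn : ∀ f, ‖synth e fun n => κ n f‖ = ‖f‖) (x : ℕ → V) (D : ℕ → V →ₗ[ℝ] V)
    (hD : ∀ n j f, κ n (D j f) ≤ κ n f) (hDx : ∀ j, D j (x j) = x j)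
    (hDx' : ∀ i j, i ≠ j → D j (x i) = 0)
    (hlim : ∀ n, Tendsto (fun j => κ n (‖x j‖⁻¹ • x j)) atTop (𝓝 0)) :
    ∃ φ : ℕ → ℕ, StrictMono φ ∧ IsComplementedSeq (x ∘ φ) := by
  by_cases hfreq : ∃ᶠ j in atTop, x j = 0
  · obtain ⟨φ, hφ, h0⟩ := extraction_of_frequently_atTop hfreq
    exact ⟨φ, hφ, isComplementedSeq_of_eq_zero h0⟩
  · obtain ⟨ψ, hψ, h0⟩ := extraction_of_frequently_atTop (not_frequently.1 hfreq).frequently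
    have hc : ∀ j, ‖x (ψ j)‖⁻¹ ≠ 0 := fun j => inv_ne_zero (norm_ne_zero_iff.2 (h0 j))
    obtain ⟨φ, hφ, h⟩ := exists_isComplementedSeq_of_norm_eq_one he hb κ hκ hκn
      (fun j => ‖x (ψ j)‖⁻¹ • x (ψ j)) (fun j => D (ψ j)) (fun n j f => hD n _ f)
      (fun j => by rw [map_smul, hDx])
      (fun i j hij => by rw [map_smul, hDx' _ _ (fun h => hij (hψ.injective h)), smul_zero])
      (fun j => by rw [norm_smul, norm_inv, norm_norm, inv_mul_cancel₀ (norm_ne_zero_iff.2 (h0 j))])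
      (fun n => (hlim n).comp hψ.tendsto_atTop)
    exact ⟨ψ ∘ φ, hψ.comp hφ, (isComplementedSeq_smul_iff fun j => hc (φ j)).1 h⟩

end Selection

/-! ### The Lions–Peetre space as a Banach function lattice. -/

section LionsPeetre

/-- The sequence of K-functionals with weights `(m n)⁻¹` and `m n`. -/
def kSeq (X₀ X₁ : RISpace) (m : ℕ → ℝ) (f : L0) (n : ℕ) : ℝ :=
  kFunctional X₀ X₁ (m n)⁻¹ (m n) f

variable {X₀ X₁ : RISpace} {m : ℕ → ℝ} (hle : X₀.carrier ≤ X₁.carrier) (hm1 : ∀ n, 1 ≤ m n)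

include hle in
theorem mem_right_of_mem_sup {f : L0} (hf : f ∈ X₀.carrier ⊔ X₁.carrier) : f ∈ X₁.carrier :=
  sup_le hle le_rfl hf

include hm1

theorem kSeq_nonneg (f : L0) (n : ℕ) : 0 ≤ kSeq X₀ X₁ m f n :=
  have := hm1 n
  kFunctional_nonneg (by positivity) (by positivity) f

theorem kSeq_add_le {f g : L0} (hf : f ∈ X₀.carrier ⊔ X₁.carrier)
    (hg : g ∈ X₀.carrier ⊔ X₁.carrier) (n : ℕ) :
    kSeq X₀ X₁ m (f + g) n ≤ kSeq X₀ X₁ m f n + kSeq X₀ X₁ m g n :=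
  have := hm1 n
  kFunctional_add_le (by positivity) (by positivity) hf hg

theorem kSeq_smul (c : ℝ) {f : L0} (hf : f ∈ X₀.carrier ⊔ X₁.carrier) (n : ℕ) :
    kSeq X₀ X₁ m (c • f) n = |c| * kSeq X₀ X₁ m f n :=
  have := hm1 n
  kFunctional_smul (by positivity) (by positivity) c hf

theorem kSeq_smul_eq (c : ℝ) {f : L0} (hf : f ∈ X₀.carrier ⊔ X₁.carrier) :
    kSeq X₀ X₁ m (c • f) = fun n => |c| * kSeq X₀ X₁ m f n :=
  funext fun n => kSeq_smul hm1 c hf n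

theorem kSeq_neg {f : L0} (hf : f ∈ X₀.carrier ⊔ X₁.carrier) (n : ℕ) :
    kSeq X₀ X₁ m (-f) n = kSeq X₀ X₁ m f n := by
  have := kSeq_smul hm1 (-1) hf n
  rwa [neg_one_smul, abs_neg, abs_one, one_mul] at this

theorem kSeq_zero (n : ℕ) : kSeq X₀ X₁ m 0 n = 0 := by
  have := kSeq_smul hm1 0 (zero_mem (X₀.carrier ⊔ X₁.carrier)) n
  rwa [zero_smul, abs_zero, zero_mul] at this

theorem kSeq_mono {f g : L0} (hfg : |f| ≤ |g|) (hg : g ∈ X₀.carrier ⊔ X₁.carrier) (n : ℕ) :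
    kSeq X₀ X₁ m f n ≤ kSeq X₀ X₁ m g n :=
  have := hm1 n
  kFunctional_mono (by positivity) (by positivity) hfg hg

theorem kSeq_le_left (f : X₀) (n : ℕ) : kSeq X₀ X₁ m (f : L0) n ≤ (m n)⁻¹ * ‖f‖ :=
  have := hm1 n
  kFunctional_le_left (by positivity) (by positivity) f

theorem kSeq_le_right (f : X₁) (n : ℕ) : kSeq X₀ X₁ m (f : L0) n ≤ m n * ‖f‖ :=
  have := hm1 n
  kFunctional_le_right (by positivity) (by positivity) f

variable (hn : ∀ f : X₀, ‖(Submodule.inclusion hle f : X₁)‖ ≤ ‖f‖)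
include hn

/-- Since `m n ≥ 1` and the embedding is contractive, every decomposition costs at least `‖f‖ / m
n`. So a single K-functional controls the `X₁`-norm. -/
theorem norm_le_mul_kSeq (f : X₁) (n : ℕ) : ‖f‖ ≤ m n * kSeq X₀ X₁ m (f : L0) n := by
  have h1 := hm1 n
  have h0 : 0 < m n := by linarith
  rw [← div_le_iff₀' h0]
  refine le_of_forall_pos_le_add fun ε hε => ?_
  obtain ⟨f₀, f₁, hf, hlt⟩ := exists_of_kFunctional_lt (X₀ := X₀) (X₁ := X₁) (α := (m n)⁻¹)
    (β := m n) (f := (f : L0)) (Submodule.mem_sup_right f.2) (lt_add_of_pos_right _ hε)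
  refine le_trans ?_ hlt.le
  have hf' : f = Submodule.inclusion hle f₀ + f₁ := Subtype.ext hf
  have h2 : ‖f‖ ≤ ‖f₀‖ + ‖f₁‖ := by
    rw [hf']
    exact (norm_add_le _ _).trans (add_le_add_left (hn f₀) _)
  rw [div_eq_inv_mul]
  have h3 := mul_le_mul_of_nonneg_left h2 (inv_nonneg.2 h0.le)
  have h4 : (m n)⁻¹ * ‖f₁‖ ≤ m n * ‖f₁‖ :=
    mul_le_mul_of_nonneg_right ((inv_le_one_of_one_le₀ h1).trans h1) (norm_nonneg _)
  linarith

variable {E : Type*} [NormedAddCommGroup E] [NormedSpace ℝ E] [CompleteSpace E]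
  {e : SchauderBasis ℝ E} (he : IsNormalizedOneUnconditional e)
include he

omit hn in
theorem expandable_kSeq_add {f g : L0} (hf : f ∈ X₀.carrier ⊔ X₁.carrier)
    (hg : g ∈ X₀.carrier ⊔ X₁.carrier) (hfe : Expandable e (kSeq X₀ X₁ m f))
    (hge : Expandable e (kSeq X₀ X₁ m g)) :
    Expandable e (kSeq X₀ X₁ m (f + g)) ∧
      ‖synth e (kSeq X₀ X₁ m (f + g))‖ ≤
        ‖synth e (kSeq X₀ X₁ m f)‖ + ‖synth e (kSeq X₀ X₁ m g)‖ := by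
  have h1 : ∀ n, |kSeq X₀ X₁ m (f + g) n| ≤ |kSeq X₀ X₁ m f n + kSeq X₀ X₁ m g n| := fun n =>
    abs_le_abs_of_nonneg (kSeq_nonneg hm1 _ _) (kSeq_add_le hm1 hf hg n)
  have h2 := he.expandable_of_abs_le (hfe.add hge) h1
  refine ⟨h2, (he.norm_synth_le h2 (hfe.add hge) h1).trans ?_⟩
  rw [synth_add hfe hge]
  exact norm_add_le _ _

omit hn in
theorem expandable_kSeq_of_abs_le {f g : L0} (hfg : |f| ≤ |g|) (hg : g ∈ X₀.carrier ⊔ X₁.carrier)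
    (hge : Expandable e (kSeq X₀ X₁ m g)) :
    Expandable e (kSeq X₀ X₁ m f) ∧
      ‖synth e (kSeq X₀ X₁ m f)‖ ≤ ‖synth e (kSeq X₀ X₁ m g)‖ := by
  have h1 : ∀ n, |kSeq X₀ X₁ m f n| ≤ |kSeq X₀ X₁ m g n| := fun n =>
    abs_le_abs_of_nonneg (kSeq_nonneg hm1 _ _) (kSeq_mono hm1 hfg hg n)
  have h2 := he.expandable_of_abs_le hge h1
  exact ⟨h2, he.norm_synth_le h2 hge h1⟩

omit hn in
/-- The linear space underlying the Lions-Peetre space. -/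
def lionsPeetreCarrier : Submodule ℝ L0 where
  carrier := {f | f ∈ X₀.carrier ⊔ X₁.carrier ∧ Expandable e (kSeq X₀ X₁ m f)}
  add_mem' hf hg := ⟨add_mem hf.1 hg.1, (expandable_kSeq_add hm1 he hf.1 hg.1 hf.2 hg.2).1⟩
  zero_mem' := by
    refine ⟨zero_mem _, ?_⟩
    have : kSeq X₀ X₁ m 0 = 0 := funext fun n => kSeq_zero hm1 n
    rw [this]
    simpa using! expandable_finset e ∅ 0
  smul_mem' c f hf := by
    refine ⟨Submodule.smul_mem _ c hf.1, ?_⟩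
    rw [kSeq_smul_eq hm1 c hf.1]
    exact hf.2.const_mul _

/-- The limit is found in `X₁`, where each K-functional is continuous; norm bounds on finite sets of
coordinates pass to the limit, and expandability is inherited from an approximating term. -/
theorem lionsPeetre_complete (u : ℕ → lionsPeetreCarrier (X₀ := X₀) (X₁ := X₁) hm1 he)
    (hu : ∀ ε > 0, ∃ N, ∀ i ≥ N, ∀ j ≥ N,
      ‖synth e (kSeq X₀ X₁ m ((u i - u j : lionsPeetreCarrier hm1 he) : L0))‖ < ε) :
    ∃ f : lionsPeetreCarrier (X₀ := X₀) (X₁ := X₁) hm1 he,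
      Tendsto (fun i => ‖synth e (kSeq X₀ X₁ m ((u i - f : lionsPeetreCarrier hm1 he) : L0))‖)
        atTop (𝓝 0) := by
  let u' : ℕ → X₁ := fun i => ⟨u i, mem_right_of_mem_sup hle (u i).2.1⟩
  have hcs : CauchySeq u' := by
    refine Metric.cauchySeq_iff.2 fun ε hε => ?_
    have h0 : 0 < m 0 := by linarith [hm1 0]
    obtain ⟨N, hN⟩ := hu (ε / m 0) (by positivity)
    refine ⟨N, fun i hi j hj => ?_⟩
    rw [dist_eq_norm]
    refine (norm_le_mul_kSeq hle hm1 hn (u' i - u' j) 0).trans_lt ?_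
    have h1 := he.abs_le_norm_synth (u i - u j).2.2 0
    have h2 := (le_abs_self _).trans_lt (h1.trans_lt (hN i hi j hj))
    rw [lt_div_iff₀' h0] at h2
    exact h2
  obtain ⟨f, hf⟩ := cauchySeq_tendsto_of_complete hcs
  have hfs : (f : L0) ∈ X₀.carrier ⊔ X₁.carrier := Submodule.mem_sup_right f.2
  have hus : ∀ i, (u i : L0) ∈ X₀.carrier ⊔ X₁.carrier := fun i => (u i).2.1
  have hk : ∀ n, Tendsto (fun i => kSeq X₀ X₁ m ((u i : L0) - f) n) atTop (𝓝 0) := by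
    intro n
    have h1 : Tendsto (fun i => m n * ‖u' i - f‖) atTop (𝓝 0) := by
      simpa using (tendsto_iff_norm_sub_tendsto_zero.1 hf).const_mul (m n)
    exact squeeze_zero (fun i => kSeq_nonneg hm1 _ _) (fun i => kSeq_le_right hm1 (u' i - f) n) h1
  have hks : ∀ s : Finset ℕ,
      Tendsto (fun i => ‖∑ n ∈ s, kSeq X₀ X₁ m ((u i : L0) - f) n • e n‖) atTop (𝓝 0) := by
    intro s
    have : Tendsto (fun i => ∑ n ∈ s, kSeq X₀ X₁ m ((u i : L0) - f) n • e n) atTop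
        (𝓝 (∑ n ∈ s, (0 : ℝ) • e n)) := tendsto_finsetSum _ fun n _ => (hk n).smul_const _
    simpa using this.norm
  have hbound : ∀ ε > 0, ∃ N, ∀ i ≥ N, ∀ s : Finset ℕ,
      ‖∑ n ∈ s, kSeq X₀ X₁ m ((u i : L0) - f) n • e n‖ ≤ ε := by
    intro ε hε
    obtain ⟨N, hN⟩ := hu ε hε
    refine ⟨N, fun i hi s => ?_⟩
    have hlim := (hks s).const_add ε
    rw [add_zero] at hlim
    refine ge_of_tendsto hlim ?_
    filter_upwards [eventually_ge_atTop N] with j hj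
    have h1 : ∀ n ∈ s, |kSeq X₀ X₁ m ((u i : L0) - f) n| ≤
        |kSeq X₀ X₁ m ((u i : L0) - u j) n + kSeq X₀ X₁ m ((u j : L0) - f) n| := by
      intro n _
      refine abs_le_abs_of_nonneg (kSeq_nonneg hm1 _ _) ?_
      rw [← sub_add_sub_cancel (u i : L0) (u j : L0) (f : L0)]
      exact kSeq_add_le hm1 (sub_mem (hus i) (hus j)) (sub_mem (hus j) hfs) n
    refine (he.norm_sum_le s h1).trans ?_
    simp_rw [add_smul]
    rw [Finset.sum_add_distrib]
    refine (norm_add_le _ _).trans (add_le_add_left ?_ _)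
    exact (he.norm_sum_le_norm_synth (u i - u j).2.2 s).trans (hN i hi j hj).le
  have hfe : Expandable e (kSeq X₀ X₁ m f) := by
    refine IsNormalizedOneUnconditional.expandable_of_tail_le fun ε hε => ?_
    obtain ⟨i, hi⟩ := hbound (ε / 2) (half_pos hε)
    obtain ⟨N, hN⟩ := he.exists_tail_le (u i).2.2 (half_pos hε)
    refine ⟨N, fun M hM => ?_⟩
    have h1 : ∀ n ∈ Finset.Ico N M, |kSeq X₀ X₁ m (f : L0) n| ≤
        |kSeq X₀ X₁ m (u i : L0) n + kSeq X₀ X₁ m ((u i : L0) - f) n| := by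
      intro n _
      refine abs_le_abs_of_nonneg (kSeq_nonneg hm1 _ _) ?_
      rw [← kSeq_neg hm1 (sub_mem (hus i) hfs)]
      have h2 := kSeq_add_le hm1 (hus i) (neg_mem (sub_mem (hus i) hfs)) n
      rwa [neg_sub, add_sub_cancel, ← neg_sub] at h2
    refine (he.norm_sum_le _ h1).trans_lt ?_
    simp_rw [add_smul]
    rw [Finset.sum_add_distrib]
    have h3 := hN (Finset.Ico N M) fun n hn => (Finset.mem_Ico.1 hn).1
    have h4 := hi i le_rfl (Finset.Ico N M)
    exact (norm_add_le _ _).trans_lt (by linarith)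
  refine ⟨⟨f, hfs, hfe⟩, ?_⟩
  refine Metric.tendsto_atTop.2 fun ε hε => ?_
  obtain ⟨N, hN⟩ := hbound (ε / 2) (half_pos hε)
  refine ⟨N, fun i hi => ?_⟩
  rw [Real.dist_eq, sub_zero, abs_of_nonneg (norm_nonneg _)]
  refine lt_of_le_of_lt ?_ (half_lt_self hε)
  exact IsNormalizedOneUnconditional.norm_synth_le_of_sum_le
    (u i - (⟨f, hfs, hfe⟩ : lionsPeetreCarrier hm1 he)).2.2 fun M => hN i hi _

/-- The Lions-Peetre space as a Banach function lattice. -/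
def lionsPeetre : BanachFunctionLattice where
  carrier := lionsPeetreCarrier (X₀ := X₀) (X₁ := X₁) hm1 he
  nrm f := ‖synth e (kSeq X₀ X₁ m (f : L0))‖
  nrm_eq_zero f hf := by
    rw [norm_eq_zero, synth_eq_zero_iff f.2.2] at hf
    have h1 := norm_le_mul_kSeq hle hm1 hn ⟨f, mem_right_of_mem_sup hle f.2.1⟩ 0
    have h2 : kSeq X₀ X₁ m (f : L0) 0 = 0 := congrFun hf 0
    rw [h2, mul_zero, norm_le_zero_iff] at h1
    exact Subtype.ext (congrArg (fun g : X₁ => (g : L0)) h1)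
  nrm_smul c f := by
    have : kSeq X₀ X₁ m ((c • f : lionsPeetreCarrier hm1 he) : L0)
        = fun n => |c| * kSeq X₀ X₁ m (f : L0) n := kSeq_smul_eq hm1 c f.2.1
    rw [this, synth_const_mul f.2.2, norm_smul, Real.norm_eq_abs, abs_abs]
  nrm_add_le f g := (expandable_kSeq_add hm1 he f.2.1 g.2.1 f.2.2 g.2.2).2
  ideal f g hfg hg := ⟨mem_sup_of_abs_le hfg hg.1,
    (expandable_kSeq_of_abs_le hm1 he hfg hg.1 hg.2).1⟩
  nrm_le f g hfg := (expandable_kSeq_of_abs_le hm1 he hfg g.2.1 g.2.2).2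
  complete := lionsPeetre_complete hle hm1 hn he

theorem norm_lionsPeetre (f : lionsPeetre hle hm1 hn he) :
    ‖f‖ = ‖synth e (kSeq X₀ X₁ m (f : L0))‖ := rfl

theorem kSeq_le_norm (f : lionsPeetre hle hm1 hn he) (n : ℕ) :
    kSeq X₀ X₁ m (f : L0) n ≤ ‖f‖ :=
  (le_abs_self _).trans (he.abs_le_norm_synth f.2.2 n)

/-- The K-functionals as seminorms in the Lions-Peetre space. -/
def kSeminorm (n : ℕ) : Seminorm ℝ (lionsPeetre hle hm1 hn he) :=
  Seminorm.of (fun f => kSeq X₀ X₁ m (f : L0) n)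
    (fun f g => kSeq_add_le hm1 f.2.1 g.2.1 n)
    (fun c f => kSeq_smul hm1 c f.2.1 n)

theorem kSeminorm_apply (n : ℕ) (f : lionsPeetre hle hm1 hn he) :
    kSeminorm hle hm1 hn he n f = kSeq X₀ X₁ m (f : L0) n := rfl

/-- Here `k_n(f) ≤ ‖f‖ / m n`, which is summable. -/
theorem mem_lionsPeetre_of_left (hsum : Summable fun n => (m n)⁻¹) (f : X₀) :
    (f : L0) ∈ (lionsPeetre hle hm1 hn he).carrier := by
  refine ⟨Submodule.mem_sup_left f.2, ?_⟩
  refine he.expandable_of_summable ?_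
  exact Summable.of_nonneg_of_le (kSeq_nonneg hm1 _) (kSeq_le_left hm1 f) (hsum.mul_right _)

end LionsPeetre

/-! ### Strictness: absolute continuity, null K-functionals, separability. -/

section LionsPeetre

variable {X₀ X₁ : RISpace} {m : ℕ → ℝ} (hle : X₀.carrier ≤ X₁.carrier) (hm1 : ∀ n, 1 ≤ m n)
  (hstrict : ∀ x : ℕ → X₀, (∃ C : ℝ, ∀ n, ‖x n‖ ≤ C) →
    Tendsto (fun n => volume {t : I | (x n : L0) t ≠ 0}) atTop (𝓝 0) →
    Tendsto (fun n => ‖(Submodule.inclusion hle (x n) : X₁)‖) atTop (𝓝 0))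

theorem L0.volume_support_mulLeft_ind_le {A : Set I} (hA : MeasurableSet A) (f : L0) :
    volume {t : I | L0.mulLeft (L0.ind hA) f t ≠ 0} ≤ volume A := by
  refine measure_mono_ae ?_
  filter_upwards [L0.coeFn_mulLeft (L0.ind hA) f, L0.coeFn_ind hA] with t h1 h2 ht
  by_contra hn
  refine ht ?_
  have hn' : t ∉ A := hn
  rw [h1, h2]
  simp [hn']

include hm1 hstrict

/-- Restrict a near-optimal decomposition to `A j`. The `X₀`-part is bounded by `m n * C` with
shrinking support, so strictness kills it in `X₁`; the `X₁`-part is at most `C / m n`. -/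
theorem eventually_norm_le_of_kSeq_lt {A : ℕ → Set I} (hA : ∀ j, MeasurableSet (A j))
    (hA0 : Tendsto (fun j => volume (A j)) atTop (𝓝 0)) (F : ℕ → X₁)
    (hF : ∀ j, L0.mulLeft (L0.ind (hA j)) (F j : L0) = F j) {C : ℝ} (n : ℕ)
    (hC : ∀ j, kSeq X₀ X₁ m (F j : L0) n < C) {δ : ℝ} (hδ : 0 < δ) :
    ∀ᶠ j in atTop, ‖F j‖ ≤ δ + C * (m n)⁻¹ := by
  have h0 : 0 < m n := by linarith [hm1 n]
  choose a b hab hlt using fun j => exists_of_kFunctional_lt (X₀ := X₀) (X₁ := X₁)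
    (α := (m n)⁻¹) (β := m n) (f := (F j : L0)) (Submodule.mem_sup_right (F j).2) (hC j)
  let a' : ℕ → X₀ := fun j => X₀.mulOp (L0.ind (hA j)) (L0.abs_ind_le_one (hA j)) (a j)
  let b' : ℕ → X₁ := fun j => X₁.mulOp (L0.ind (hA j)) (L0.abs_ind_le_one (hA j)) (b j)
  have hF' : ∀ j, F j = Submodule.inclusion hle (a' j) + b' j := fun j => by
    apply Subtype.ext
    rw [← hF j, hab j, map_add]
    rfl
  have ha : Tendsto (fun j => ‖(Submodule.inclusion hle (a' j) : X₁)‖) atTop (𝓝 0) := by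
    refine hstrict a' ⟨m n * C, fun j => ?_⟩ ?_
    · refine (X₀.norm_mulOp_le _ _ _).trans ?_
      rw [← inv_mul_le_iff₀ h0]
      have : 0 ≤ m n * ‖b j‖ := by positivity
      linarith [hlt j]
    · exact tendsto_of_tendsto_of_tendsto_of_le_of_le tendsto_const_nhds hA0
        (fun _ => zero_le) (fun j => L0.volume_support_mulLeft_ind_le (hA j) _)
  filter_upwards [ha.eventually_lt_const hδ] with j hj
  rw [hF' j]
  have hb : ‖b' j‖ ≤ C * (m n)⁻¹ := by
    refine (X₁.norm_mulOp_le _ _ _).trans ?_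
    rw [← div_eq_mul_inv, le_div_iff₀' h0]
    have : 0 ≤ (m n)⁻¹ * ‖a j‖ := by positivity
    linarith [hlt j]
  exact (norm_add_le _ _).trans (add_le_add hj.le hb)

variable (hn : ∀ f : X₀, ‖(Submodule.inclusion hle f : X₁)‖ ≤ ‖f‖)
  {E : Type*} [NormedAddCommGroup E] [NormedSpace ℝ E] [CompleteSpace E]
  {e : SchauderBasis ℝ E} (he : IsNormalizedOneUnconditional e)

/-- The norm of the Lions-Peetre space is absolutely continuous. -/
theorem tendsto_norm_mulOp_ind (f : lionsPeetre hle hm1 hn he) {A : ℕ → Set I}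
    (hA : ∀ j, MeasurableSet (A j)) (hA0 : Tendsto (fun j => volume (A j)) atTop (𝓝 0)) :
    Tendsto (fun j => ‖(lionsPeetre hle hm1 hn he).mulOp (L0.ind (hA j))
      (L0.abs_ind_le_one (hA j)) f‖) atTop (𝓝 0) := by
  set g : ℕ → lionsPeetre hle hm1 hn he := fun j =>
    (lionsPeetre hle hm1 hn he).mulOp (L0.ind (hA j)) (L0.abs_ind_le_one (hA j)) f with hg
  have hgf : ∀ j n, kSeq X₀ X₁ m (g j : L0) n ≤ kSeq X₀ X₁ m (f : L0) n := fun j n =>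
    kSeq_mono hm1 (L0.abs_mulLeft_le (L0.abs_ind_le_one (hA j)) _) f.2.1 n
  let F : ℕ → X₁ := fun j => ⟨g j, mem_right_of_mem_sup hle (g j).2.1⟩
  have hFF : ∀ j, L0.mulLeft (L0.ind (hA j)) (F j : L0) = F j := fun j => by
    apply AEEqFun.ext
    filter_upwards [L0.coeFn_mulLeft (L0.ind (hA j)) (F j : L0),
      L0.coeFn_mulLeft (L0.ind (hA j)) (f : L0), L0.coeFn_ind (hA j)] with t h1 h2 h3
    have h4 : (F j : L0) t = L0.ind (hA j) t * (f : L0) t := h2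
    rw [h1, h4, h3]
    by_cases ht : t ∈ A j <;> simp [ht]
  have hF : Tendsto (fun j => ‖F j‖) atTop (𝓝 0) := by
    refine Metric.tendsto_atTop'.2 fun ε hε => ?_
    -- Only one index `N` with `k_N(f) < ε / 4` is needed here, as `(m N)⁻¹ ≤ 1`.
    obtain ⟨N, hN⟩ := he.exists_tail_le f.2.2 (show 0 < ε / 4 by positivity)
    have h1 : kSeq X₀ X₁ m (f : L0) N < ε / 4 := by
      have := hN {N} (by simp)
      rw [Finset.sum_singleton, norm_smul, he.norm_basis, mul_one] at this
      exact (le_abs_self _).trans_lt this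
    obtain ⟨M, hM⟩ := eventually_atTop.1 (eventually_norm_le_of_kSeq_lt hle hm1 hstrict hA hA0 F hFF
      N (fun j => (hgf j N).trans_lt h1) (show 0 < ε / 4 by positivity))
    refine ⟨M, fun j hj => ?_⟩
    rw [Real.dist_eq, sub_zero, abs_of_nonneg (norm_nonneg _)]
    refine (hM j hj.le).trans_lt ?_
    have h2 : (m N)⁻¹ ≤ 1 := inv_le_one_of_one_le₀ (hm1 N)
    nlinarith
  have hk : ∀ n, Tendsto (fun j => kSeq X₀ X₁ m (g j : L0) n) atTop (𝓝 0) := fun n => by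
    have h1 := hF.const_mul (m n)
    rw [mul_zero] at h1
    exact squeeze_zero (fun j => kSeq_nonneg hm1 _ _) (fun j => kSeq_le_right hm1 (F j) n) h1
  refine Metric.tendsto_atTop'.2 fun ε hε => ?_
  obtain ⟨N, hN⟩ := he.exists_tail_le f.2.2 (show 0 < ε / 3 by positivity)
  have hs : Tendsto (fun j => ‖∑ n ∈ Finset.range N, kSeq X₀ X₁ m (g j : L0) n • e n‖) atTop
      (𝓝 0) := by
    have : Tendsto (fun j => ∑ n ∈ Finset.range N, kSeq X₀ X₁ m (g j : L0) n • e n) atTop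
        (𝓝 (∑ n ∈ Finset.range N, (0 : ℝ) • e n)) :=
      tendsto_finsetSum _ fun n _ => (hk n).smul_const _
    simpa using this.norm
  obtain ⟨M, hM⟩ := eventually_atTop.1 (hs.eventually_lt_const (show 0 < ε / 3 by positivity))
  refine ⟨M, fun j hj => ?_⟩
  rw [Real.dist_eq, sub_zero, abs_of_nonneg (norm_nonneg _)]
  have : ‖g j‖ ≤ ε / 3 + ε / 3 := by
    refine IsNormalizedOneUnconditional.norm_synth_le_of_sum_le (g j).2.2 fun K => ?_
    refine (he.norm_sum_mono (Finset.range_mono (le_max_left K N)) _).trans ?_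
    rw [← Finset.sum_range_add_sum_Ico _ (le_max_right K N)]
    refine (norm_add_le _ _).trans (add_le_add (hM j hj.le).le ?_)
    refine (he.norm_sum_le _ (b := kSeq X₀ X₁ m (f : L0)) fun n _ =>
      abs_le_abs_of_nonneg (kSeq_nonneg hm1 _ _) (hgf j n)).trans ?_
    exact (hN _ fun n hn => (Finset.mem_Ico.1 hn).1).le
  exact this.trans_lt (by linarith)

/-- For disjoint bounded sequences in the Lions-Peetre space each of the K-functionals
tends to zero. -/
theorem tendsto_kSeq_of_disjoint (hm0 : Tendsto (fun n => (m n)⁻¹) atTop (𝓝 0))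
    (f : ℕ → lionsPeetre hle hm1 hn he) (hf : ∀ j, ‖f j‖ ≤ 1)
    (hd : ∀ i j, i ≠ j → ∀ᵐ t, (f i : L0) t = 0 ∨ (f j : L0) t = 0) (n : ℕ) :
    Tendsto (fun j => kSeq X₀ X₁ m (f j : L0) n) atTop (𝓝 0) := by
  have hA := fun j => L0.measurableSet_support (f j : L0)
  -- Disjoint supports have summable measures.
  have hA0 : Tendsto (fun j => volume {t : I | (f j : L0) t ≠ 0}) atTop (𝓝 0) := by
    refine ENNReal.tendsto_atTop_zero_of_tsum_ne_top ?_
    refine ne_top_of_le_ne_top (measure_ne_top volume _)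
      (tsum_meas_le_meas_iUnion_of_disjoint₀ volume (fun j => (hA j).nullMeasurableSet)
        fun i j hij => ?_)
    change volume _ = 0
    rw [← nonpos_iff_eq_zero, ← measure_empty (μ := (volume : Measure I))]
    refine measure_mono_ae ?_
    filter_upwards [hd i j hij] with t ht ht'
    rcases ht with h | h
    · exact (ht'.1 h).elim
    · exact (ht'.2 h).elim
  let F : ℕ → X₁ := fun j => ⟨f j, mem_right_of_mem_sup hle (f j).2.1⟩
  have hF : Tendsto (fun j => ‖F j‖) atTop (𝓝 0) := by
    refine Metric.tendsto_atTop'.2 fun ε hε => ?_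
    -- The K-functionals are merely bounded by `1 < 2 = C`, so smallness comes from choosing `(m
    -- N)⁻¹ < ε / 4`.
    obtain ⟨N, hN⟩ := (hm0.eventually_lt_const (show 0 < ε / 4 by positivity)).exists
    obtain ⟨M, hM⟩ := eventually_atTop.1 (eventually_norm_le_of_kSeq_lt hle hm1 hstrict hA hA0 F
      (fun j => L0.mulLeft_ind_support _) (C := 2) N
      (fun j => ((kSeq_le_norm hle hm1 hn he (f j) N).trans (hf j)).trans_lt one_lt_two)
      (show 0 < ε / 4 by positivity))
    refine ⟨M, fun j hj => ?_⟩
    rw [Real.dist_eq, sub_zero, abs_of_nonneg (norm_nonneg _)]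
    exact (hM j hj.le).trans_lt (by linarith)
  have h1 := hF.const_mul (m n)
  rw [mul_zero] at h1
  exact squeeze_zero (fun j => kSeq_nonneg hm1 _ _) (fun j => kSeq_le_right hm1 (F j) n) h1

/-- Truncation reduces to bounded functions by absolute continuity. Among functions bounded by `N`,
convergence in `L¹` gives convergence in measure and hence in `W`, so countable dense subsets in
`L¹` suffice. -/
theorem isSeparable_lionsPeetre (hsum : Summable fun n => (m n)⁻¹)
    (hone : (1 : L0) ∈ X₀.carrier) : (lionsPeetre hle hm1 hn he).IsSeparable := by
  set W := lionsPeetre hle hm1 hn he with hW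
  have hone' : (1 : L0) ∈ W.carrier := mem_lionsPeetre_of_left hle hm1 hn he hsum ⟨1, hone⟩
  have hbdd : ∀ (N : ℕ) (g : L0), (∀ᵐ t, |g t| ≤ N) → g ∈ W.carrier := fun N g hg => by
    refine W.ideal g ((N : ℝ) • (1 : L0)) ?_ (Submodule.smul_mem _ _ hone')
    rw [L0.abs_le_abs_iff]
    filter_upwards [hg, AEEqFun.coeFn_smul (N : ℝ) (1 : L0),
      (AEEqFun.coeFn_one : ⇑(1 : L0) =ᵐ[volume] 1)] with t h1 h2 h3
    rw [h2, Pi.smul_apply, h3]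
    simpa using h1
  let S : ℕ → Set (Lp ℝ 1 (volume : Measure I)) := fun N => {g | ∀ᵐ t, |(g : L0) t| ≤ N}
  have : Fact ((1 : ℝ≥0∞) ≠ ∞) := ⟨ENNReal.one_ne_top⟩
  choose c hcS hcc hcd using fun N =>
    (TopologicalSpace.IsSeparable.of_separableSpace (S N)).exists_countable_dense_subset
  let T : Set W := {w | (w : L0) ∈ ⋃ N, (fun g : Lp ℝ 1 (volume : Measure I) => (g : L0)) '' c N}
  have hT : T.Countable :=
    (Set.countable_iUnion fun N => (hcc N).image _).preimage Subtype.val_injective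
  refine ⟨T, hT, Metric.dense_iff.2 fun f ε hε => ?_⟩
  -- truncation
  let A : ℕ → Set I := fun N => {t | (N : ℝ) < |(f : L0) t|}
  have hA : ∀ N, MeasurableSet (A N) := fun N =>
    measurableSet_lt measurable_const (f : L0).measurable.abs
  have hA0 : Tendsto (fun N => volume (A N)) atTop (𝓝 0) := by
    have h1 := tendsto_measure_iInter_atTop (μ := volume) (s := A)
      (fun N => (hA N).nullMeasurableSet)
      (fun N M hNM t (ht : (M : ℝ) < _) => (Nat.cast_le.2 hNM).trans_lt ht)
      ⟨0, measure_ne_top _ _⟩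
    have h2 : ⋂ N, A N = ∅ := by
      refine Set.eq_empty_of_forall_notMem fun t ht => ?_
      obtain ⟨N, hN⟩ := exists_nat_ge |(f : L0) t|
      exact not_lt.2 hN (Set.mem_iInter.1 ht N)
    rwa [h2, measure_empty] at h1
  obtain ⟨N, hN⟩ := ((tendsto_norm_mulOp_ind hle hm1 hstrict hn he f hA hA0).eventually_lt_const
    (show 0 < ε / 3 by positivity)).exists
  set g : W := f - W.mulOp (L0.ind (hA N)) (L0.abs_ind_le_one (hA N)) f with hg
  have hgN : ∀ᵐ t, |(g : L0) t| ≤ N := by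
    filter_upwards [AEEqFun.coeFn_sub (f : L0) (L0.mulLeft (L0.ind (hA N)) f),
      L0.coeFn_mulLeft (L0.ind (hA N)) (f : L0), L0.coeFn_ind (hA N)] with t h1 h2 h3
    have h4 : (g : L0) t = (f : L0) t - L0.ind (hA N) t * (f : L0) t := by
      rw [← h2]; exact h1
    rw [h4, h3]
    by_cases ht : t ∈ A N
    · simp [ht]
    · have h5 : |(f : L0) t| ≤ N := not_lt.1 fun h => ht h
      simpa [ht] using h5
  have hgL : MemLp ((g : L0) : I → ℝ) 1 volume :=
    MemLp.of_bound (g : L0).aestronglyMeasurable N (by simpa using hgN)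
  have hgcoe : ((hgL.toLp _ : Lp ℝ 1 (volume : Measure I)) : L0) = g := by
    apply AEEqFun.ext
    exact hgL.coeFn_toLp
  have hgS : hgL.toLp _ ∈ S N := by
    change ∀ᵐ t, |((hgL.toLp _ : Lp ℝ 1 (volume : Measure I)) : L0) t| ≤ N
    rw [hgcoe]
    exact hgN
  obtain ⟨h, hhc, hhlim⟩ := mem_closure_iff_seq_limit.1 (hcd N hgS)
  have hmeas := tendstoInMeasure_of_tendsto_Lp hhlim
  -- approximation in measure
  set K := ‖(⟨1, hone'⟩ : W)‖ with hK
  have hK0 : 0 ≤ K := norm_nonneg _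
  set δ : ℝ := ε / (3 * (K + 1)) with hδ
  have hδ0 : 0 < δ := by positivity
  let B : ℕ → Set I := fun j => {t | δ < |((h j : L0) - (g : L0)) t|}
  have hB : ∀ j, MeasurableSet (B j) := fun j =>
    measurableSet_lt measurable_const ((h j : L0) - (g : L0)).measurable.abs
  have hB0 : Tendsto (fun j => volume (B j)) atTop (𝓝 0) := by
    refine tendsto_of_tendsto_of_tendsto_of_le_of_le tendsto_const_nhds
      (tendstoInMeasure_iff_dist.1 hmeas δ hδ0) (fun _ => zero_le) (fun j => ?_)
    refine measure_mono_ae ?_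
    have h0 : ∀ᵐ t, ((hgL.toLp _ : Lp ℝ 1 (volume : Measure I)) : L0) t = (g : L0) t := by
      rw [hgcoe]; exact Eventually.of_forall fun _ => rfl
    filter_upwards [AEEqFun.coeFn_sub (h j : L0) (g : L0), h0] with t h1 h2 h3
    have h4 : δ < |((h j : L0) - (g : L0)) t| := h3
    rw [h1] at h4
    change δ ≤ dist _ _
    rw [Real.dist_eq, h2]
    exact h4.le
  -- Two functions bounded by `N` differ by at most `δ` off `B j` and by at most `2 N` on it.
  obtain ⟨j, hj⟩ := ((tendsto_norm_mulOp_ind hle hm1 hstrict hn he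
    (⟨(2 * N : ℝ) • (1 : L0), Submodule.smul_mem _ _ hone'⟩ : W) hB hB0).eventually_lt_const
    (show 0 < ε / 3 by positivity)).exists
  have hhS : ∀ᵐ t, |(h j : L0) t| ≤ N := hcS N (hhc j)
  let w : W := ⟨h j, hbdd N _ hhS⟩
  refine ⟨w, ?_, Set.mem_iUnion.2 ⟨N, h j, hhc j, rfl⟩⟩
  rw [Metric.mem_ball, dist_eq_norm]
  have h1 : ‖w - g‖ ≤ ‖δ • (⟨1, hone'⟩ : W) + W.mulOp (L0.ind (hB j)) (L0.abs_ind_le_one (hB j))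
      (⟨(2 * N : ℝ) • (1 : L0), Submodule.smul_mem _ _ hone'⟩ : W)‖ := by
    refine W.norm_le_of_abs_le ?_
    change |(h j : L0) - (g : L0)| ≤ |δ • (1 : L0) +
      L0.mulLeft (L0.ind (hB j)) ((2 * N : ℝ) • (1 : L0))|
    rw [L0.abs_le_abs_iff]
    filter_upwards [AEEqFun.coeFn_sub (h j : L0) (g : L0), hgN, hhS, L0.coeFn_ind (hB j),
      L0.coeFn_mulLeft (L0.ind (hB j)) ((2 * N : ℝ) • (1 : L0)),
      AEEqFun.coeFn_smul (2 * N : ℝ) (1 : L0), AEEqFun.coeFn_smul δ (1 : L0),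
      (AEEqFun.coeFn_one : ⇑(1 : L0) =ᵐ[volume] 1),
      AEEqFun.coeFn_add (δ • (1 : L0)) (L0.mulLeft (L0.ind (hB j)) ((2 * N : ℝ) • (1 : L0)))]
      with t a1 a2 a3 a4 a5 a6 a7 a8 a9
    rw [a9, Pi.add_apply, a5, a6, a7, Pi.smul_apply, Pi.smul_apply, a8, a4, Pi.one_apply]
    by_cases ht : t ∈ B j
    · rw [a1, Pi.sub_apply]
      simp only [smul_eq_mul, mul_one, ht, Set.indicator_of_mem, one_mul]
      have := abs_sub ((h j : L0) t) ((g : L0) t)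
      refine le_trans ?_ (le_abs_self _)
      linarith
    · have : |((h j : L0) - (g : L0)) t| ≤ δ := not_lt.1 fun h => ht h
      simp only [smul_eq_mul, mul_one, ht, Set.indicator_of_notMem, zero_mul, add_zero,
        not_false_eq_true]
      exact this.trans (le_abs_self _)
  have h2 : δ * K ≤ ε / 3 := by
    rw [hδ, div_mul_eq_mul_div, div_le_div_iff₀ (by positivity) (by norm_num)]
    nlinarith
  have h3 : ‖w - g‖ < ε / 3 + ε / 3 := by
    refine h1.trans_lt ((norm_add_le _ _).trans_lt ?_)
    rw [norm_smul, Real.norm_of_nonneg hδ0.le]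
    exact add_lt_add_of_le_of_lt h2 hj
  have h4 : ‖g - f‖ < ε / 3 := by
    rw [hg, sub_sub_cancel_left, norm_neg]
    exact hN
  have h5 : w - f = (w - g) + (g - f) := by abel
  rw [h5]
  exact (norm_add_le _ _).trans_lt (by linarith)

/-- The Lions-Peetre space as a rearrangement invariant space. -/
def lionsPeetreRI (hsum : Summable fun n => (m n)⁻¹) (hone : (1 : L0) ∈ X₀.carrier) : RISpace where
  toBanachFunctionLattice := lionsPeetre hle hm1 hn he
  rearrange f g hfg hg := by
    refine ⟨hfg.mem_sup hone hg.1, ?_⟩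
    have : kSeq X₀ X₁ m f = kSeq X₀ X₁ m g := funext fun n =>
      have := hm1 n
      hfg.kFunctional_eq hone (by positivity) (by positivity) hg.1
    rw [this]
    exact hg.2
  nrm_rearrange f g hfg := by
    have : kSeq X₀ X₁ m (f : L0) = kSeq X₀ X₁ m (g : L0) := funext fun n =>
      have := hm1 n
      hfg.kFunctional_eq hone (by positivity) (by positivity) g.2.1
    change ‖synth e (kSeq X₀ X₁ m (f : L0))‖ = ‖synth e (kSeq X₀ X₁ m (g : L0))‖
    rw [this]
  separable_or_maximal := Or.inl (isSeparable_lionsPeetre hle hm1 hstrict hn he hsum hone)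

end LionsPeetre

/-! ### Norms of indicator functions in r.i. spaces. -/

section Indicators

theorem L0.abs_ind_le_abs_ind {A B : Set I} (hA : MeasurableSet A) (hB : MeasurableSet B)
    (h : A ⊆ B) : |L0.ind hA| ≤ |L0.ind hB| := by
  rw [L0.abs_le_abs_iff]
  filter_upwards [L0.coeFn_ind hA, L0.coeFn_ind hB] with t h1 h2
  rw [h1, h2]
  by_cases ht : t ∈ A
  · simp [ht, h ht]
  · simp [ht]

theorem L0.equimeasurable_ind {A B : Set I} (hA : MeasurableSet A) (hB : MeasurableSet B)
    (h : volume A = volume B) : Equimeasurable (L0.ind hA) (L0.ind hB) := by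
  have key : ∀ {C : Set I} (hC : MeasurableSet C) (τ : ℝ), 0 < τ →
      volume {t : I | τ < |L0.ind hC t|} = if τ < 1 then volume C else 0 := by
    intro C hC τ hτ
    have h1 : volume {t : I | τ < |L0.ind hC t|}
        = volume {t : I | τ < |C.indicator (fun _ => (1 : ℝ)) t|} := by
      refine measure_congr ?_
      filter_upwards [L0.coeFn_ind hC] with t ht
      change (τ < |L0.ind hC t|) = (τ < |C.indicator (fun _ => (1 : ℝ)) t|)
      rw [ht]
    rw [h1]
    split_ifs with h
    · congr 1
      ext t
      by_cases ht : t ∈ C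
      · simp [ht, h]
      · simp [ht, hτ.le]
    · convert measure_empty (μ := (volume : Measure I))
      ext t
      by_cases ht : t ∈ C
      · simpa [ht] using not_lt.1 h
      · simp [ht, hτ.le]
  intro τ hτ
  rw [key hA τ hτ, key hB τ hτ, h]

theorem L0.ind_ne_zero {A : Set I} (hA : MeasurableSet A) (h : volume A ≠ 0) : L0.ind hA ≠ 0 := by
  intro h0
  refine h (measure_mono_null_ae (t := ∅) ?_ measure_empty)
  filter_upwards [L0.coeFn_ind hA, L0.coeFn_zero] with t h1 h2 ht
  rw [h0, h2, Set.indicator_of_mem ht] at h1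
  exact (zero_ne_one h1).elim

variable (X : RISpace) (hone : (1 : L0) ∈ X.carrier)
include hone

theorem RISpace.ind_mem {A : Set I} (hA : MeasurableSet A) : L0.ind hA ∈ X.carrier := by
  refine X.ideal _ _ ?_ hone
  rw [L0.abs_le_abs_iff]
  filter_upwards [L0.abs_ind_le_one hA, (AEEqFun.coeFn_one : ⇑(1 : L0) =ᵐ[volume] 1)] with t h1 h2
  rw [h2]
  simpa using h1

/-- The norm of an indicator function. -/
def RISpace.normInd {A : Set I} (hA : MeasurableSet A) : ℝ :=
  ‖(⟨L0.ind hA, X.ind_mem hone hA⟩ : X)‖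

theorem RISpace.normInd_eq {A B : Set I} (hA : MeasurableSet A) (hB : MeasurableSet B)
    (h : volume A = volume B) : X.normInd hone hA = X.normInd hone hB :=
  X.nrm_rearrange ⟨_, X.ind_mem hone hA⟩ ⟨_, X.ind_mem hone hB⟩ (L0.equimeasurable_ind hA hB h)

omit hone in
theorem volume_Iic_measureReal (A : Set I) :
    volume (Set.Iic (⟨volume.real A, measureReal_nonneg, measureReal_le_one⟩ : I)) = volume A := by
  rw [unitInterval.volume_Iic]
  exact ofReal_measureReal

theorem RISpace.normInd_mono {A B : Set I} (hA : MeasurableSet A) (hB : MeasurableSet B)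
    (h : volume A ≤ volume B) : X.normInd hone hA ≤ X.normInd hone hB := by
  rw [← X.normInd_eq hone measurableSet_Iic hA (volume_Iic_measureReal A),
    ← X.normInd_eq hone measurableSet_Iic hB (volume_Iic_measureReal B)]
  refine X.norm_le_of_abs_le (L0.abs_ind_le_abs_ind measurableSet_Iic measurableSet_Iic
    (Set.Iic_subset_Iic.2 ?_))
  exact Subtype.mk_le_mk.2 (ENNReal.toReal_mono (measure_ne_top _ _) h)

/-- Replace `A` by an initial interval of equal measure and cut it into halves; each half has
measure at most that of `B`. -/
theorem RISpace.normInd_le_two_mul {A B : Set I} (hA : MeasurableSet A) (hB : MeasurableSet B)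
    (h : volume A ≤ 2 * volume B) : X.normInd hone hA ≤ 2 * X.normInd hone hB := by
  set s : I := ⟨volume.real A, measureReal_nonneg, measureReal_le_one⟩ with hs
  have hs0 : 0 ≤ (s : ℝ) := s.2.1
  set r : I := ⟨(s : ℝ) / 2, by linarith, by linarith [s.2.2]⟩ with hr
  have hsB : ENNReal.ofReal ((s : ℝ) / 2) ≤ volume B := by
    have h1 : (s : ℝ) ≤ 2 * volume.real B := by
      have := ENNReal.toReal_mono (ENNReal.mul_ne_top (by norm_num) (measure_ne_top _ _)) h
      simpa [ENNReal.toReal_mul] using! this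
    refine ENNReal.ofReal_le_of_le_toReal ?_
    change (s : ℝ) / 2 ≤ volume.real B
    linarith
  have h1 : X.normInd hone (measurableSet_Iic (a := r)) ≤ X.normInd hone hB :=
    X.normInd_mono hone _ _ (by rw [unitInterval.volume_Iic]; exact hsB)
  have h2 : X.normInd hone (measurableSet_Ioc (a := r) (b := s)) ≤ X.normInd hone hB :=
    X.normInd_mono hone _ _ (by
      rw [unitInterval.volume_Ioc]
      have : (s : ℝ) - r = s / 2 := by rw [hr]; ring
      rwa [this])
  rw [← X.normInd_eq hone measurableSet_Iic hA (volume_Iic_measureReal A)]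
  have h3 : X.normInd hone (measurableSet_Iic (a := s)) ≤
      ‖(⟨L0.ind (measurableSet_Iic (a := r)), X.ind_mem hone _⟩ : X) +
        ⟨L0.ind (measurableSet_Ioc (a := r) (b := s)), X.ind_mem hone _⟩‖ := by
    refine X.norm_le_of_abs_le ?_
    change |L0.ind (measurableSet_Iic (a := s))| ≤ |L0.ind (measurableSet_Iic (a := r)) +
      L0.ind (measurableSet_Ioc (a := r) (b := s))|
    rw [L0.abs_le_abs_iff]
    filter_upwards [L0.coeFn_ind (measurableSet_Iic (a := s)),
      L0.coeFn_ind (measurableSet_Iic (a := r)), L0.coeFn_ind (measurableSet_Ioc (a := r) (b := s)),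
      AEEqFun.coeFn_add (L0.ind (measurableSet_Iic (a := r)))
        (L0.ind (measurableSet_Ioc (a := r) (b := s)))] with t a1 a2 a3 a4
    rw [a4, Pi.add_apply, a1, a2, a3]
    by_cases hts : t ≤ s
    · by_cases htr : t ≤ r
      · simp [hts, htr, not_lt.2 htr]
      · simp [hts, htr, not_le.1 htr]
    · rw [Set.indicator_of_notMem (by simpa using hts), abs_zero]
      exact abs_nonneg _
  refine h3.trans ((norm_add_le _ _).trans ?_)
  rw [two_mul]
  exact add_le_add h1 h2

theorem RISpace.normInd_pos {A : Set I} (hA : MeasurableSet A) (h : volume A ≠ 0) :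
    0 < X.normInd hone hA :=
  norm_pos_iff.2 fun h0 => L0.ind_ne_zero hA h (congrArg (fun f : X => (f : L0)) h0)

theorem RISpace.normInd_le_of_half_le {A B : Set I} (hA : MeasurableSet A) (hB : MeasurableSet B)
    (h : volume A ≤ 2 * volume B) (f : X) (hf : ∀ t ∈ B, 1 / 2 ≤ |(f : L0) t|) :
    X.normInd hone hA ≤ 4 * ‖f‖ := by
  have h1 : X.normInd hone hB ≤ ‖(2 : ℝ) • f‖ := by
    refine X.norm_le_of_abs_le ?_
    change |L0.ind hB| ≤ |(2 : ℝ) • (f : L0)|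
    rw [L0.abs_le_abs_iff]
    filter_upwards [L0.coeFn_ind hB, AEEqFun.coeFn_smul (2 : ℝ) (f : L0)] with t a1 a2
    rw [a1, a2, Pi.smul_apply, smul_eq_mul, abs_mul, abs_two]
    by_cases ht : t ∈ B
    · simp only [ht, Set.indicator_of_mem, abs_one]
      linarith [hf t ht]
    · simp [ht]
  rw [norm_smul, Real.norm_of_nonneg zero_le_two] at h1
  linarith [X.normInd_le_two_mul hone hA hB h]

end Indicators

/-! ### Disjoint functions adapted to the K-functionals. -/

section Embedding

variable {X₀ X₁ : RISpace} {m : ℕ → ℝ} (hle : X₀.carrier ≤ X₁.carrier)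
  (hone : (1 : L0) ∈ X₀.carrier)

/-- In a decomposition of the indicator, at each point of `A` one of the terms is at least `1/2` in
absolute value, so one of them is on a set of at least half the measure of `A`. Each halving costs a
factor `2`. -/
theorem min_le_kFunctional_ind {α β : ℝ} (hα : 0 ≤ α) (hβ : 0 ≤ β) {A : Set I}
    (hA : MeasurableSet A) :
    min (α * X₀.normInd hone hA) (β * X₁.normInd (hle hone) hA) / 4 ≤
      kFunctional X₀ X₁ α β (L0.ind hA) := by
  refine le_of_forall_pos_le_add fun ε hε => ?_
  obtain ⟨f₀, f₁, hf, hlt⟩ := exists_of_kFunctional_lt (X₀ := X₀) (X₁ := X₁) (α := α) (β := β)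
    (f := L0.ind hA) (Submodule.mem_sup_left (X₀.ind_mem hone hA)) (lt_add_of_pos_right _ hε)
  refine le_trans ?_ hlt.le
  have hB : ∀ f : L0, MeasurableSet {t : I | 1 / 2 ≤ |f t|} := fun f =>
    measurableSet_le measurable_const f.measurable.abs
  have hsub : volume A ≤ volume {t : I | 1 / 2 ≤ |(f₀ : L0) t|} +
      volume {t : I | 1 / 2 ≤ |(f₁ : L0) t|} := by
    refine le_trans (measure_mono_ae ?_) (measure_union_le _ _)
    filter_upwards [L0.coeFn_ind hA, AEEqFun.coeFn_add (f₀ : L0) (f₁ : L0)] with t h1 h2 ht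
    rw [← hf, h1, Set.indicator_of_mem ht, Pi.add_apply] at h2
    by_contra hcon
    have h3 : ¬ (1 / 2 ≤ |(f₀ : L0) t| ∨ 1 / 2 ≤ |(f₁ : L0) t|) := hcon
    push Not at h3
    have h4 := abs_add_le ((f₀ : L0) t) ((f₁ : L0) t)
    rw [← h2, abs_one] at h4
    linarith
  have h0 := norm_nonneg f₀
  have h1 := norm_nonneg f₁
  rcases le_total (volume {t : I | 1 / 2 ≤ |(f₀ : L0) t|})
    (volume {t : I | 1 / 2 ≤ |(f₁ : L0) t|}) with h | h
  · have h2 := X₁.normInd_le_of_half_le (hle hone) hA (hB f₁)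
      (hsub.trans (by rw [two_mul]; exact add_le_add_left h _)) f₁ fun t ht => ht
    have h3 := min_le_right (α * X₀.normInd hone hA) (β * X₁.normInd (hle hone) hA)
    have h4 := mul_le_mul_of_nonneg_left h2 hβ
    have h5 := mul_nonneg hα h0
    linarith
  · have h2 := X₀.normInd_le_of_half_le hone hA (hB f₀)
      (hsub.trans (by rw [two_mul]; exact add_le_add_right h _)) f₀ fun t ht => ht
    have h3 := min_le_left (α * X₀.normInd hone hA) (β * X₁.normInd (hle hone) hA)
    have h4 := mul_le_mul_of_nonneg_left h2 hα
    have h5 := mul_nonneg hβ h1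
    linarith

/-- The points `2⁻ʲ` of the unit interval. -/
def dyadicPoint (j : ℕ) : I :=
  ⟨(1 / 2) ^ j, by positivity, pow_le_one₀ (by norm_num) (by norm_num)⟩

/-- The dyadic intervals `(2⁻ʲ⁻¹, 2⁻ʲ]`. -/
def dyadicInterval (j : ℕ) : Set I :=
  Set.Ioc (dyadicPoint (j + 1)) (dyadicPoint j)

theorem measurableSet_dyadicInterval (j : ℕ) : MeasurableSet (dyadicInterval j) :=
  measurableSet_Ioc

theorem volume_dyadicInterval (j : ℕ) :
    volume (dyadicInterval j) = ENNReal.ofReal ((1 / 2) ^ (j + 1)) := by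
  rw [dyadicInterval, unitInterval.volume_Ioc]
  congr 1
  simp only [dyadicPoint]
  ring

theorem disjoint_dyadicInterval {i j : ℕ} (h : i ≠ j) :
    Disjoint (dyadicInterval i) (dyadicInterval j) := by
  have key : ∀ i j, i < j → Disjoint (dyadicInterval i) (dyadicInterval j) := by
    intro i j hij
    refine Set.disjoint_left.2 fun t h1 h2 => ?_
    have h3 : dyadicPoint j ≤ dyadicPoint (i + 1) :=
      Subtype.mk_le_mk.2 (pow_le_pow_of_le_one (by norm_num) (by norm_num) hij)
    exact absurd (h1.1.trans_le (h2.2.trans h3)) (lt_irrefl _)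
  rcases lt_or_gt_of_ne h with h | h
  · exact key i j h
  · exact (key j i h).symm

theorem tendsto_volume_dyadicInterval :
    Tendsto (fun j => volume (dyadicInterval j)) atTop (𝓝 0) := by
  simp_rw [volume_dyadicInterval]
  have h1 : Tendsto (fun j : ℕ => ((1 : ℝ) / 2) ^ (j + 1)) atTop (𝓝 0) :=
    (tendsto_pow_atTop_nhds_zero_of_lt_one (by norm_num) (by norm_num)).comp
      (tendsto_add_atTop_nat 1)
  simpa using ENNReal.tendsto_ofReal h1

theorem L0.ind_eq_zero_or_of_disjoint {A B : Set I} (hA : MeasurableSet A) (hB : MeasurableSet B)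
    (h : Disjoint A B) : ∀ᵐ t, L0.ind hA t = 0 ∨ L0.ind hB t = 0 := by
  filter_upwards [L0.coeFn_ind hA, L0.coeFn_ind hB] with t h1 h2
  rw [h1, h2]
  by_cases ht : t ∈ A
  · right
    simp [Set.disjoint_left.1 h ht]
  · left
    simp [ht]

variable (hm2 : ∀ n, 2 ≤ m n) (hmm : ∀ i j, i < j → 2 * m i ≤ m j)
  (hstrict : ∀ x : ℕ → X₀, (∃ C : ℝ, ∀ n, ‖x n‖ ≤ C) →
    Tendsto (fun n => volume {t : I | (x n : L0) t ≠ 0}) atTop (𝓝 0) →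
    Tendsto (fun n => ‖(Submodule.inclusion hle (x n) : X₁)‖) atTop (𝓝 0))
  (hone₀ : ‖(⟨1, hone⟩ : X₀)‖ = 1) (hone₁ : ‖(⟨1, hle hone⟩ : X₁)‖ = 1)
include hm2 hmm hstrict hone₀ hone₁

/-- Multiples of indicators of disjoint sets on which the `n`-th K-functional dominates. -/
theorem exists_disjoint_kSeq : ∃ g : ℕ → X₀,
    (∀ i j, i ≠ j → ∀ᵐ t, (g i : L0) t = 0 ∨ (g j : L0) t = 0) ∧ (∀ n, ‖g n‖ ≤ m n) ∧
    (∀ n, ‖(Submodule.inclusion hle (g n) : X₁)‖ ≤ (m n)⁻¹) ∧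
    ∀ n, 1 / 8 ≤ kSeq X₀ X₁ m (g n : L0) n := by
  set φ₀ : ℕ → ℝ := fun j => X₀.normInd hone (measurableSet_dyadicInterval j) with hφ₀
  set φ₁ : ℕ → ℝ := fun j => X₁.normInd (hle hone) (measurableSet_dyadicInterval j) with hφ₁
  have hvol : ∀ j, volume (dyadicInterval j) ≠ 0 := fun j => by
    rw [volume_dyadicInterval, ne_eq, ENNReal.ofReal_eq_zero, not_le]
    positivity
  have hpos₀ : ∀ j, 0 < φ₀ j := fun j => X₀.normInd_pos hone _ (hvol j)
  have hpos₁ : ∀ j, 0 < φ₁ j := fun j => X₁.normInd_pos (hle hone) _ (hvol j)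
  have hanti : ∀ j, φ₀ (j + 1) ≤ φ₀ j := fun j => by
    refine X₀.normInd_mono hone _ _ ?_
    rw [volume_dyadicInterval, volume_dyadicInterval]
    exact ENNReal.ofReal_le_ofReal (pow_le_pow_of_le_one (by norm_num) (by norm_num) (by lia))
  have hdouble : ∀ j, φ₁ j ≤ 2 * φ₁ (j + 1) := fun j => by
    refine X₁.normInd_le_two_mul (hle hone) _ _ ?_
    rw [volume_dyadicInterval, volume_dyadicInterval, ← ENNReal.ofReal_ofNat,
      ← ENNReal.ofReal_mul (by norm_num)]
    exact ENNReal.ofReal_le_ofReal (le_of_eq (by ring))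
  have hind_univ : L0.ind MeasurableSet.univ = 1 := by
    apply AEEqFun.ext
    filter_upwards [L0.coeFn_ind MeasurableSet.univ, (AEEqFun.coeFn_one : ⇑(1 : L0) =ᵐ[volume] 1)]
      with t h1 h2
    rw [h1, h2]
    simp
  have huniv₀ : X₀.normInd hone MeasurableSet.univ = 1 := by
    rw [← hone₀, RISpace.normInd]
    congr 2
  have huniv₁ : X₁.normInd (hle hone) MeasurableSet.univ = 1 := by
    rw [← hone₁, RISpace.normInd]
    congr 2
  have hφ₀0 : φ₀ 0 ≤ 1 := by
    rw [← huniv₀]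
    exact X₀.normInd_mono hone _ _ (measure_mono (Set.subset_univ _))
  have hφ₁0 : 1 ≤ 2 * φ₁ 0 := by
    rw [← huniv₁]
    refine X₁.normInd_le_two_mul (hle hone) _ _ ?_
    rw [volume_dyadicInterval, ← ENNReal.ofReal_ofNat, ← ENNReal.ofReal_mul (by norm_num)]
    simp
  -- Strictness applied to indicators normalized in `X₀`.
  have hratio : Tendsto (fun j => φ₁ j / φ₀ j) atTop (𝓝 0) := by
    have h1 := hstrict (fun j => (φ₀ j)⁻¹ • (⟨L0.ind (measurableSet_dyadicInterval j),
      X₀.ind_mem hone _⟩ : X₀)) ⟨1, fun j => ?_⟩ ?_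
    · refine h1.congr fun j => ?_
      rw [map_smul, norm_smul, Real.norm_of_nonneg (inv_nonneg.2 (hpos₀ j).le), div_eq_inv_mul]
      rfl
    · rw [norm_smul, Real.norm_of_nonneg (inv_nonneg.2 (hpos₀ j).le)]
      exact le_of_eq (inv_mul_cancel₀ (hpos₀ j).ne')
    · refine tendsto_of_tendsto_of_tendsto_of_le_of_le tendsto_const_nhds
        tendsto_volume_dyadicInterval (fun _ => zero_le) (fun j => measure_mono_ae ?_)
      filter_upwards [L0.coeFn_ind (measurableSet_dyadicInterval j),
        AEEqFun.coeFn_smul (φ₀ j)⁻¹ (L0.ind (measurableSet_dyadicInterval j))] with t h1 h2 ht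
      by_contra hcon
      refine ht (h2.trans ?_)
      have hcon' : t ∉ dyadicInterval j := hcon
      rw [Pi.smul_apply, h1]
      simp [hcon']
  have hex : ∀ n, ∃ j, m n ^ 2 * φ₁ j ≤ φ₀ j := fun n => by
    have hp : 0 < (m n ^ 2)⁻¹ := by
      have := hm2 n
      positivity
    obtain ⟨j, hj⟩ := (hratio.eventually_lt_const hp).exists
    refine ⟨j, ?_⟩
    rw [div_lt_iff₀ (hpos₀ j), ← div_eq_inv_mul, lt_div_iff₀ (inv_pos.1 hp)] at hj
    linarith
  classical
  -- Minimality and the doubling of `φ₁` pin the ratio `φ₁ / φ₀` at `J n` between `(m n)⁻² / 2` and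
  -- `(m n)⁻²`. If `J n = 0`, the lower bound comes from the normalization at `1`.
  let J : ℕ → ℕ := fun n => Nat.find (hex n)
  have hJ : ∀ n, m n ^ 2 * φ₁ (J n) ≤ φ₀ (J n) := fun n => Nat.find_spec (hex n)
  have hJ' : ∀ n, φ₀ (J n) ≤ 2 * m n ^ 2 * φ₁ (J n) := fun n => by
    have h4 : 4 ≤ m n ^ 2 := by nlinarith [hm2 n]
    rcases Nat.eq_zero_or_pos (J n) with h0 | h0
    · rw [h0]
      nlinarith [hpos₁ 0]
    · have h1 := Nat.find_min (hex n) (show J n - 1 < J n by lia)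
      rw [not_le] at h1
      have h2 := hanti (J n - 1)
      have h3 := hdouble (J n - 1)
      rw [Nat.sub_add_cancel h0] at h2 h3
      nlinarith
  -- Doubling `m` changes `m ^ 2` by a factor `4`, more than the factor `2` of slack in the ratio.
  have hJinj : ∀ i j, i ≠ j → J i ≠ J j := by
    have key : ∀ i j, i < j → J i ≠ J j := fun i j hij h => by
      have h1 := hJ' i
      have h2 := hJ j
      rw [← h] at h2
      have h3 := hmm i j hij
      have h4 := hm2 i
      have h5 : 4 * m i ^ 2 ≤ m j ^ 2 := by nlinarith
      have h6 : 0 < m i ^ 2 * φ₁ (J i) := mul_pos (by positivity) (hpos₁ _)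
      have h7 := mul_le_mul_of_nonneg_right h5 (hpos₁ (J i)).le
      linarith
    intro i j hij
    rcases lt_or_gt_of_ne hij with h | h
    · exact key i j h
    · exact (key j i h).symm
  have hmpos : ∀ n, 0 < m n := fun n => by linarith [hm2 n]
  -- This makes the `X₀`-norm exactly `m n` and puts the `X₁`-norm between `(m n)⁻¹ / 2` and `(m
  -- n)⁻¹`; the `n`-th K-functional is then at least `min 1 (1/2) / 4`.
  let c : ℕ → ℝ := fun n => m n / φ₀ (J n)
  have hc : ∀ n, 0 < c n := fun n => div_pos (hmpos n) (hpos₀ _)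
  refine ⟨fun n => c n • ⟨L0.ind (measurableSet_dyadicInterval (J n)), X₀.ind_mem hone _⟩,
    fun i j hij => ?_, fun n => ?_, fun n => ?_, fun n => ?_⟩
  · filter_upwards [L0.ind_eq_zero_or_of_disjoint (measurableSet_dyadicInterval (J i))
      (measurableSet_dyadicInterval (J j)) (disjoint_dyadicInterval (hJinj i j hij)),
      AEEqFun.coeFn_smul (c i) (L0.ind (measurableSet_dyadicInterval (J i))),
      AEEqFun.coeFn_smul (c j) (L0.ind (measurableSet_dyadicInterval (J j)))] with t h1 h2 h3
    refine h1.imp (fun h => h2.trans ?_) (fun h => h3.trans ?_) <;> simp [h]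
  · rw [norm_smul, Real.norm_of_nonneg (hc n).le]
    exact le_of_eq (div_mul_cancel₀ _ (hpos₀ _).ne')
  · rw [map_smul, norm_smul, Real.norm_of_nonneg (hc n).le]
    change m n / φ₀ (J n) * φ₁ (J n) ≤ _
    rw [div_mul_eq_mul_div, div_le_iff₀ (hpos₀ _), le_inv_mul_iff₀ (hmpos n)]
    linarith [hJ n]
  · have h1 := min_le_kFunctional_ind (X₁ := X₁) hle hone (inv_nonneg.2 (hmpos n).le)
      (hmpos n).le (measurableSet_dyadicInterval (J n))
    have h2 := kSeq_smul (X₀ := X₀) (X₁ := X₁) (fun n => (by linarith [hm2 n] : 1 ≤ m n)) (c n)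
      (Submodule.mem_sup_left (X₀.ind_mem hone (measurableSet_dyadicInterval (J n)))) n
    refine le_of_le_of_eq ?_ h2.symm
    rw [abs_of_pos (hc n)]
    refine le_trans ?_ (mul_le_mul_of_nonneg_left h1 (hc n).le)
    change _ ≤ c n * (min ((m n)⁻¹ * φ₀ (J n)) (m n * φ₁ (J n)) / 4)
    rw [← mul_div_assoc, mul_min_of_nonneg _ _ (hc n).le]
    have h3 : c n * ((m n)⁻¹ * φ₀ (J n)) = 1 := by
      have := (hpos₀ (J n)).ne'
      have := (hmpos n).ne'
      simp only [c]
      field_simp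
    have h4 : 1 / 2 ≤ c n * (m n * φ₁ (J n)) := by
      simp only [c]
      rw [div_mul_eq_mul_div, div_le_div_iff₀ (by norm_num) (hpos₀ _)]
      linarith [hJ' n]
    rw [h3]
    have h5 : (1 : ℝ) / 2 ≤ min 1 (c n * (m n * φ₁ (J n))) := le_min (by norm_num) h4
    linarith

end Embedding

/-! ### Disjoint sequences and block bases in `E`. -/

section Lattices

theorem BanachFunctionLattice.abs_inf_abs_eq_zero_iff (X : BanachFunctionLattice) (x y : X) :
    |x| ⊓ |y| = 0 ↔ ∀ᵐ t, (x : L0) t = 0 ∨ (y : L0) t = 0 := by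
  rw [← L0.abs_inf_abs_eq_zero_iff, Subtype.ext_iff]
  rfl

variable {E : Type*} [NormedAddCommGroup E] [NormedSpace ℝ E] [CompleteSpace E] [Lattice E]
  {e : SchauderBasis ℝ E} (he : IsNormalizedOneUnconditional e)
  (horder : ∀ x y : E, x ≤ y ↔ ∀ n, e.coord n x ≤ e.coord n y)
include he horder

/-- In a disjointly complemented lattice block bases have complemented subsequences. -/
theorem IsDC.exists_isComplementedSeq_of_isBlockBasis (h : IsDC E) (u : ℕ → E)
    (hu : IsBlockBasis e u) : ∃ φ : ℕ → ℕ, StrictMono φ ∧ IsComplementedSeq (u ∘ φ) := by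
  obtain ⟨p, a, hp, hpa⟩ := hu
  refine h u fun i j hij => (he.abs_inf_abs_eq_zero_iff horder _ _).2 fun n => ?_
  rw [(hpa i).1, (hpa j).1, coord_sum, coord_sum]
  by_contra! hcon
  have hi : n ∈ Finset.Ico (p i) (p (i + 1)) := by
    by_contra hn
    exact hcon.1 (if_neg hn)
  have hj : n ∈ Finset.Ico (p j) (p (j + 1)) := by
    by_contra hn
    exact hcon.2 (if_neg hn)
  exact hij ((blockIndex_eq hp hi).symm.trans (blockIndex_eq hp hj))

/-- The selection theorem with the absolute values of coordinates as seminorms and `D j` the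
restriction to the support of `x j`. Disjointness makes each coordinate vanish eventually along the
sequence. -/
theorem isDC_of_isBlockBasis
    (hb : ∀ u : ℕ → E, IsBlockBasis e u → ∃ φ : ℕ → ℕ, StrictMono φ ∧ IsComplementedSeq (u ∘ φ)) :
    IsDC E := by
  classical
  intro x hx
  have hdisj : ∀ i j, i ≠ j → ∀ n, e.coord n (x i) = 0 ∨ e.coord n (x j) = 0 := fun i j hij =>
    (he.abs_inf_abs_eq_zero_iff horder _ _).1 (hx i j hij)
  let κ : ℕ → Seminorm ℝ E := fun n => Seminorm.of (fun f => |e.coord n f|)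
    (fun f g => by rw [map_add]; exact abs_add_le _ _)
    (fun c f => by rw [map_smul, smul_eq_mul, abs_mul, Real.norm_eq_abs])
  have hκ : ∀ f, Expandable e fun n => κ n f := fun f =>
    he.expandable_of_abs_le (expandable_coord e f) fun n => (abs_abs _).le
  have hκn : ∀ f, ‖synth e fun n => κ n f‖ = ‖f‖ := fun f => by
    refine le_antisymm ?_ ?_
    · refine (he.norm_synth_le (hκ f) (expandable_coord e f) fun n => (abs_abs _).le).trans_eq ?_
      rw [synth_coord]
    · conv_lhs => rw [← synth_coord e f]
      exact he.norm_synth_le (expandable_coord e f) (hκ f) fun n => (abs_abs _).ge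
  choose D hD using fun j => he.exists_clm_coord
    (fun n => if e.coord n (x j) = 0 then (0 : E →ₗ[ℝ] ℝ) else (e.coord n : E →ₗ[ℝ] ℝ))
    (fun f n => κ n f) hκ (fun f => (hκn f).le) (fun n f => by
      split_ifs
      · simp
      · exact le_rfl)
  refine exists_isComplementedSeq he hb κ hκ hκn x (fun j => (D j : E →ₗ[ℝ] E))
    (fun n j f => ?_) (fun j => ?_) (fun i j hij => ?_) (fun n => ?_)
  · change |e.coord n (D j f)| ≤ |e.coord n f|
    rw [hD]
    split_ifs
    · simp
    · exact le_rfl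
  · refine ext_coord (e := e) fun n => ?_
    change e.coord n (D j (x j)) = _
    rw [hD]
    split_ifs with h
    · rw [h]; rfl
    · rfl
  · refine ext_coord (e := e) fun n => ?_
    change e.coord n (D j (x i)) = _
    rw [hD, map_zero]
    split_ifs with h
    · rfl
    · exact (hdisj i j hij n).resolve_right h
  · refine tendsto_const_nhds.congr' ?_
    have hev : ∀ᶠ j in atTop, e.coord n (x j) = 0 := by
      by_cases hex : ∃ i, e.coord n (x i) ≠ 0
      · obtain ⟨i, hi⟩ := hex
        filter_upwards [eventually_gt_atTop i] with j hj
        exact (hdisj i j hj.ne n).resolve_left hi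
      · push Not at hex
        exact Eventually.of_forall hex
    filter_upwards [hev] with j hj
    change 0 = |e.coord n (‖x j‖⁻¹ • x j)|
    rw [map_smul, hj, smul_zero, abs_zero]

end Lattices

/-! ### Transfer of the DC property between `E` and `W`. -/

section LionsPeetre

variable {X₀ X₁ : RISpace} {m : ℕ → ℝ} (hle : X₀.carrier ≤ X₁.carrier) (hm1 : ∀ n, 1 ≤ m n)
  (hn : ∀ f : X₀, ‖(Submodule.inclusion hle f : X₁)‖ ≤ ‖f‖)
  {E : Type*} [NormedAddCommGroup E] [NormedSpace ℝ E] [CompleteSpace E]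
  {e : SchauderBasis ℝ E} (he : IsNormalizedOneUnconditional e)
  (hsum : Summable fun n => (m n)⁻¹)

include hsum in
theorem isDC_lionsPeetre
    (hstrict : ∀ x : ℕ → X₀, (∃ C : ℝ, ∀ n, ‖x n‖ ≤ C) →
      Tendsto (fun n => volume {t : I | (x n : L0) t ≠ 0}) atTop (𝓝 0) →
      Tendsto (fun n => ‖(Submodule.inclusion hle (x n) : X₁)‖) atTop (𝓝 0))
    (hb : ∀ u : ℕ → E, IsBlockBasis e u → ∃ φ : ℕ → ℕ, StrictMono φ ∧ IsComplementedSeq (u ∘ φ)) :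
    IsDC (lionsPeetre hle hm1 hn he) := by
  intro x hx
  have hdisj : ∀ i j, i ≠ j → ∀ᵐ t, (x i : L0) t = 0 ∨ (x j : L0) t = 0 := fun i j hij =>
    (BanachFunctionLattice.abs_inf_abs_eq_zero_iff _ _ _).1 (hx i j hij)
  refine exists_isComplementedSeq he hb (kSeminorm hle hm1 hn he) (fun f => f.2.2) (fun f => rfl) x
    (fun j => (lionsPeetre hle hm1 hn he).mulOp (L0.ind (L0.measurableSet_support (x j : L0)))
      (L0.abs_ind_le_one _)) (fun n j f => ?_) (fun j => ?_) (fun i j hij => ?_) (fun n => ?_)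
  · exact kSeq_mono hm1 (L0.abs_mulLeft_le (L0.abs_ind_le_one _) _) f.2.1 n
  · exact Subtype.ext (L0.mulLeft_ind_support _)
  · exact Subtype.ext (L0.mulLeft_ind_support_of_disjoint (hdisj j i hij.symm))
  · refine tendsto_kSeq_of_disjoint hle hm1 hstrict hn he hsum.tendsto_atTop_zero
      (fun j => ‖x j‖⁻¹ • x j) (fun j => ?_) (fun i j hij => ?_) n
    · rw [norm_smul, norm_inv, norm_norm]
      exact inv_mul_le_one
    · filter_upwards [hdisj i j hij, AEEqFun.coeFn_smul ‖x i‖⁻¹ (x i : L0),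
        AEEqFun.coeFn_smul ‖x j‖⁻¹ (x j : L0)] with t h1 h2 h3
      refine h1.imp (fun h => h2.trans ?_) (fun h => h3.trans ?_) <;> simp [h]

include hsum in
/-- The embedding of `E` onto the span of a suitable disjoint sequence. -/
theorem exists_embedding
    (hm : ∀ n, (m n)⁻¹ * ∑ i ∈ Finset.range n, m i + m n * ∑' i, (m (n + 1 + i))⁻¹
      < (1 / 2) ^ (n + 2)) {g : ℕ → X₀}
    (hdisj : ∀ i j, i ≠ j → ∀ᵐ t, (g i : L0) t = 0 ∨ (g j : L0) t = 0)
    (hg₀ : ∀ n, ‖g n‖ ≤ m n) (hg₁ : ∀ n, ‖(Submodule.inclusion hle (g n) : X₁)‖ ≤ (m n)⁻¹)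
    (hgk : ∀ n, 1 / 8 ≤ kSeq X₀ X₁ m (g n : L0) n) :
    ∃ T : E →L[ℝ] lionsPeetre hle hm1 hn he,
      (∀ n, (T (e n) : L0) = g n) ∧ ∀ z ∈ Submodule.span ℝ (Set.range e), ‖z‖ ≤ 8 * ‖T z‖ := by
  have hmpos : ∀ n, 0 < m n := fun n => by linarith [hm1 n]
  let G : ℕ → lionsPeetre hle hm1 hn he := fun n =>
    ⟨g n, mem_lionsPeetre_of_left hle hm1 hn he hsum (g n)⟩
  have hk1 : ∀ n, kSeq X₀ X₁ m (g n : L0) n ≤ 1 := fun n => by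
    refine (kSeq_le_left hm1 (g n) n).trans ?_
    rw [inv_mul_le_iff₀ (hmpos n), mul_one]
    exact hg₀ n
  have hklow : ∀ n i, kSeq X₀ X₁ m (g n : L0) i ≤ (m n)⁻¹ * m i := fun n i => by
    refine (kSeq_le_right hm1 (Submodule.inclusion hle (g n)) i).trans ?_
    rw [mul_comm]
    exact mul_le_mul_of_nonneg_right (hg₁ n) (hmpos i).le
  have hkhigh : ∀ n i, kSeq X₀ X₁ m (g n : L0) i ≤ m n * (m i)⁻¹ := fun n i => by
    refine (kSeq_le_left hm1 (g n) i).trans ?_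
    rw [mul_comm]
    exact mul_le_mul_of_nonneg_right (hg₀ n) (inv_nonneg.2 (hmpos i).le)
  -- Lacunarity: the `X₁`-bound controls `k_i(g_n)` for `i < n`, the `X₀`-bound for `i > n`, and
  -- these are the two sums in `hm`.
  have hoff : ∀ n K, n < K → ‖∑ i ∈ Finset.range K, kSeq X₀ X₁ m (g n : L0) i • e i
      - kSeq X₀ X₁ m (g n : L0) n • e n‖ ≤ 1 / 4 * (1 / 2) ^ n := by
    intro n K hnK
    rw [← Finset.sum_range_add_sum_Ico _ (Nat.succ_le_of_lt hnK), Finset.sum_range_succ]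
    have h3 : ∀ u w z : E, u + w + z - w = u + z := fun u w z => by abel
    rw [h3]
    have hnorm : ∀ s : Finset ℕ, ‖∑ i ∈ s, kSeq X₀ X₁ m (g n : L0) i • e i‖ ≤
        ∑ i ∈ s, kSeq X₀ X₁ m (g n : L0) i := fun s => by
      refine (norm_sum_le _ _).trans_eq (Finset.sum_congr rfl fun i _ => ?_)
      rw [norm_smul, he.norm_basis, mul_one, Real.norm_of_nonneg (kSeq_nonneg hm1 _ _)]
    have h1 : ∑ i ∈ Finset.range n, kSeq X₀ X₁ m (g n : L0) i ≤
        (m n)⁻¹ * ∑ i ∈ Finset.range n, m i := by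
      rw [Finset.mul_sum]
      exact Finset.sum_le_sum fun i _ => hklow n i
    have h2 : ∑ i ∈ Finset.Ico (n + 1) K, kSeq X₀ X₁ m (g n : L0) i ≤
        m n * ∑' i, (m (n + 1 + i))⁻¹ := by
      refine (Finset.sum_le_sum fun i _ => hkhigh n i).trans ?_
      rw [← Finset.mul_sum, Finset.sum_Ico_eq_sum_range]
      refine mul_le_mul_of_nonneg_left ?_ (hmpos n).le
      refine Summable.sum_le_tsum _ (fun i _ => inv_nonneg.2 (hmpos _).le) ?_
      simp_rw [add_comm (n + 1)]
      exact (summable_nat_add_iff (f := fun i => (m i)⁻¹) (n + 1)).2 hsum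
    have h4 := hm n
    rw [pow_add] at h4
    refine (norm_add_le _ _).trans ((add_le_add (hnorm _) (hnorm _)).trans ?_)
    linarith
  have hmem : ∀ n, (g n : L0) ∈ X₀.carrier ⊔ X₁.carrier := fun n => Submodule.mem_sup_left (g n).2
  have hcoe : ∀ (s : Finset ℕ) (c : ℕ → ℝ), ((∑ n ∈ s, c n • G n : lionsPeetre hle hm1 hn he) : L0)
      = ∑ n ∈ s, c n • (g n : L0) := fun s c => by
    rw [AddSubmonoidClass.coe_finsetSum]
    rfl
  have hsupm : ∀ (s : Finset ℕ) (c : ℕ → ℝ), ∑ n ∈ s, c n • (g n : L0) ∈ X₀.carrier ⊔ X₁.carrier :=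
    fun s c => Submodule.sum_mem _ fun n _ => Submodule.smul_mem _ _ (hmem n)
  have hupper : ∀ (s : Finset ℕ) (c : ℕ → ℝ),
      ‖∑ n ∈ s, c n • G n‖ ≤ 2 * ‖∑ n ∈ s, c n • e n‖ := by
    intro s c
    set A := ‖∑ n ∈ s, c n • e n‖ with hA
    obtain ⟨M, hM⟩ := s.exists_nat_subset_range
    rw [norm_lionsPeetre]
    refine IsNormalizedOneUnconditional.norm_synth_le_of_sum_le (∑ n ∈ s, c n • G n).2.2 fun N => ?_
    rw [hcoe]
    refine (he.norm_sum_mono (Finset.range_mono (le_max_left N M)) _).trans ?_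
    set K := max N M with hK
    have h1 : ‖∑ i ∈ Finset.range K, kSeq X₀ X₁ m (∑ n ∈ s, c n • (g n : L0)) i • e i‖ ≤
        ‖∑ i ∈ Finset.range K, (∑ n ∈ s, |c n| * kSeq X₀ X₁ m (g n : L0) i) • e i‖ := by
      refine he.norm_sum_le _ fun i _ => abs_le_abs_of_nonneg (kSeq_nonneg hm1 _ _) ?_
      have h := Finset.le_sum_of_subadditive (kSeminorm hle hm1 hn he i)
        (map_zero (kSeminorm hle hm1 hn he i)).le (map_add_le_add (kSeminorm hle hm1 hn he i)) s
        (fun n => c n • G n)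
      rw [kSeminorm_apply, hcoe] at h
      refine h.trans_eq (Finset.sum_congr rfl fun n _ => ?_)
      exact kSeq_smul hm1 (c n) (hmem n) i
    have h2 : ∑ i ∈ Finset.range K, (∑ n ∈ s, |c n| * kSeq X₀ X₁ m (g n : L0) i) • e i
        = ∑ n ∈ s, (|c n| * kSeq X₀ X₁ m (g n : L0) n) • e n + ∑ n ∈ s, |c n| •
          (∑ i ∈ Finset.range K, kSeq X₀ X₁ m (g n : L0) i • e i
            - kSeq X₀ X₁ m (g n : L0) n • e n) := by
      rw [← Finset.sum_add_distrib]
      simp_rw [mul_smul, ← smul_add, add_sub_cancel, Finset.sum_smul, Finset.smul_sum, mul_smul]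
      exact Finset.sum_comm
    have h3 : ‖∑ n ∈ s, (|c n| * kSeq X₀ X₁ m (g n : L0) n) • e n‖ ≤ A := by
      refine he.norm_sum_le _ fun n _ => ?_
      rw [abs_mul, abs_abs, abs_of_nonneg (kSeq_nonneg hm1 _ _)]
      exact mul_le_of_le_one_right (abs_nonneg _) (hk1 n)
    -- Each `|c n|` is at most `A`, so the off-diagonal errors are dominated by a geometric series.
    have h4 : ‖∑ n ∈ s, |c n| • (∑ i ∈ Finset.range K, kSeq X₀ X₁ m (g n : L0) i • e i
            - kSeq X₀ X₁ m (g n : L0) n • e n)‖ ≤ A := by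
      refine (norm_sum_le _ _).trans ?_
      have h5 : ∀ n ∈ s, ‖|c n| • (∑ i ∈ Finset.range K, kSeq X₀ X₁ m (g n : L0) i • e i
            - kSeq X₀ X₁ m (g n : L0) n • e n)‖ ≤ A / 4 * (1 / 2) ^ n := by
        intro n hns
        rw [norm_smul, Real.norm_eq_abs, abs_abs]
        refine (mul_le_mul (he.abs_le_norm_sum s c hns) (hoff n K
          ((Finset.mem_range.1 (hM hns)).trans_le (le_max_right _ _))) (norm_nonneg _)
          (norm_nonneg _)).trans_eq ?_
        rw [← hA]
        ring
      refine (Finset.sum_le_sum h5).trans ?_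
      rw [← Finset.mul_sum]
      have h6 : ∑ n ∈ s, ((1 : ℝ) / 2) ^ n ≤ 2 := by
        refine le_of_le_of_eq ?_ tsum_geometric_two
        exact summable_geometric_two.sum_le_tsum _ fun _ _ => by positivity
      have h7 : 0 ≤ A / 4 := by positivity
      nlinarith
    refine h1.trans ?_
    rw [h2]
    refine (norm_add_le _ _).trans ?_
    linarith
  obtain ⟨T, hT⟩ := he.exists_clm G 2 hupper
  refine ⟨T, fun n => by rw [hT], fun z hz => ?_⟩
  obtain ⟨c, M, rfl⟩ := exists_sum_range_of_mem_span hz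
  have hTz : T (∑ n ∈ Finset.range M, c n • e n) = ∑ n ∈ Finset.range M, c n • G n := by
    rw [map_sum]
    simp_rw [map_smul, hT]
  rw [hTz, norm_lionsPeetre]
  refine le_trans ?_ (mul_le_mul_of_nonneg_left (he.norm_sum_le_norm_synth
    (∑ n ∈ Finset.range M, c n • G n).2.2 (Finset.range M)) (by norm_num))
  rw [hcoe, ← Real.norm_of_nonneg (show (0 : ℝ) ≤ 8 by norm_num), ← norm_smul, Finset.smul_sum]
  simp_rw [smul_smul]
  refine he.norm_sum_le _ fun i hi => ?_
  rw [abs_mul, abs_of_pos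
    (show (0 : ℝ) < 8 by norm_num), abs_of_nonneg (kSeq_nonneg hm1 _ _)]
  -- Restricting to the support of `g i` isolates `c i • g i`, so the `i`-th K-functional of the
  -- whole combination is at least `|c i| / 8`.
  have h1 : L0.mulLeft (L0.ind (L0.measurableSet_support (g i : L0)))
      (∑ n ∈ Finset.range M, c n • (g n : L0)) = c i • (g i : L0) := by
    rw [map_sum, Finset.sum_eq_single_of_mem i hi fun n _ hni => ?_]
    · rw [map_smul, L0.mulLeft_ind_support]
    · rw [map_smul, L0.mulLeft_ind_support_of_disjoint (hdisj i n hni.symm), smul_zero]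
  have h2 := kSeq_mono hm1 (L0.abs_mulLeft_le (L0.abs_ind_le_one
    (L0.measurableSet_support (g i : L0))) _) (hsupm (Finset.range M) c) i
  rw [h1, kSeq_smul hm1 (c i) (hmem i)] at h2
  have h3 := mul_le_mul_of_nonneg_left (hgk i) (abs_nonneg (c i))
  linarith

/-- The images under `T` of blocks are supported on disjoint unions of supports of the `g k`, so
they are disjoint in `W`, and `T` pulls complementation back. -/
theorem exists_isComplementedSeq_of_isDC_lionsPeetre {g : ℕ → X₀}
    (hdisj : ∀ i j, i ≠ j → ∀ᵐ t, (g i : L0) t = 0 ∨ (g j : L0) t = 0)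
    (T : E →L[ℝ] lionsPeetre hle hm1 hn he) (hTg : ∀ n, (T (e n) : L0) = g n)
    (hT : ∀ z ∈ Submodule.span ℝ (Set.range e), ‖z‖ ≤ 8 * ‖T z‖)
    (hDC : IsDC (lionsPeetre hle hm1 hn he)) (u : ℕ → E) (hu : IsBlockBasis e u) :
    ∃ φ : ℕ → ℕ, StrictMono φ ∧ IsComplementedSeq (u ∘ φ) := by
  obtain ⟨p, a, hp, hpa⟩ := hu
  have hTu : ∀ j, (T (u j) : L0) = ∑ k ∈ Finset.Ico (p j) (p (j + 1)), a k • (g k : L0) := fun j => by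
    rw [(hpa j).1, map_sum, AddSubmonoidClass.coe_finsetSum]
    refine Finset.sum_congr rfl fun k _ => ?_
    rw [map_smul, ← hTg]
    rfl
  have hall : ∀ᵐ t, ∀ i j, i ≠ j → (g i : L0) t = 0 ∨ (g j : L0) t = 0 := by
    simp_rw [ae_all_iff]
    exact hdisj
  have hzero : ∀ j, ∀ᵐ t, (T (u j) : L0) t = 0 ∨
      ∃ k ∈ Finset.Ico (p j) (p (j + 1)), (g k : L0) t ≠ 0 := fun j => by
    have h1 : ∀ᵐ t, ∀ k, (a k • (g k : L0)) t = a k * (g k : L0) t :=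
      ae_all_iff.2 fun k => AEEqFun.coeFn_smul (a k) (g k : L0)
    filter_upwards [h1, AEEqFun.coeFn_fun_finsetSum (Finset.Ico (p j) (p (j + 1)))
      fun k => a k • (g k : L0)] with t h1 h2
    rw [hTu, h2]
    by_contra! hcon
    refine hcon.1 (Finset.sum_eq_zero fun k hk => ?_)
    rw [h1, hcon.2 k hk, mul_zero]
  obtain ⟨φ, hφ, hc⟩ := hDC (fun j => T (u j)) (fun i j hij => by
    rw [BanachFunctionLattice.abs_inf_abs_eq_zero_iff]
    filter_upwards [hall, hzero i, hzero j] with t h1 h2 h3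
    rcases h2 with h2 | ⟨k, hk, hk'⟩
    · exact Or.inl h2
    rcases h3 with h3 | ⟨l, hl, hl'⟩
    · exact Or.inr h3
    have hkl : k ≠ l := by
      rintro rfl
      exact hij ((blockIndex_eq hp hk).symm.trans (blockIndex_eq hp hl))
    exact ((h1 k l hkl).elim hk' hl').elim)
  refine ⟨φ, hφ, IsComplementedSeq.of_map T 8 (fun z hz => hT z ?_) hc⟩
  refine (Submodule.span_le.2 ?_) hz
  rintro _ ⟨j, rfl⟩
  rw [Function.comp_apply, (hpa _).1]
  exact Submodule.sum_mem _ fun k _ => Submodule.smul_mem _ _ (Submodule.subset_span ⟨k, rfl⟩)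

end LionsPeetre

/-! ### Normalization, lacunarity and the main theorem. -/

theorem RISpace.one_mem_and_norm_one {X : RISpace} (h : X.fundamental 1 = 1) :
    ∃ hone : (1 : L0) ∈ X.carrier, ‖(⟨1, hone⟩ : X)‖ = 1 := by
  have h1 : X.extNorm 1 = 1 := by
    rw [← h, BanachFunctionLattice.fundamental]
    congr 1
    apply AEEqFun.ext
    refine EventuallyEq.trans ?_ (AEEqFun.coeFn_mk _ _).symm
    filter_upwards [(AEEqFun.coeFn_one : ⇑(1 : L0) =ᵐ[volume] 1)] with t h
    have ht : (t : ℝ) ≤ 1 := t.2.2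
    rw [h, Set.indicator_of_mem (show t ∈ {s : I | (s : ℝ) ≤ 1} from ht)]
    rfl
  have hone := X.mem_of_extNorm_ne_top (h1.trans_ne ENNReal.one_ne_top)
  refine ⟨hone, ?_⟩
  rw [X.extNorm_of_mem hone, ENNReal.ofReal_eq_one] at h1
  exact h1

/-- Already the first sum in `hm` gives `m i / m j < 1/2`. With indices starting at `0`, the bound
`2 ^ (-n - 1)` reads `(1 / 2) ^ (n + 2)`. -/
theorem two_mul_le_of_lt {m : ℕ → ℝ} (hmono : Monotone m) (hm0 : 2 ≤ m 0)
    (hm : ∀ n, (m n)⁻¹ * ∑ i ∈ Finset.range n, m i + m n * ∑' i, (m (n + 1 + i))⁻¹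
      < (1 / 2) ^ (n + 2)) (i j : ℕ) (hij : i < j) : 2 * m i ≤ m j := by
  have hpos : ∀ n, 0 < m n := fun n => by linarith [hmono (Nat.zero_le n)]
  have h1 := hm j
  have h2 : 0 ≤ m j * ∑' i, (m (j + 1 + i))⁻¹ :=
    mul_nonneg (hpos j).le (tsum_nonneg fun i => inv_nonneg.2 (hpos _).le)
  have h3 : m i ≤ ∑ i ∈ Finset.range j, m i :=
    Finset.single_le_sum (fun n _ => (hpos n).le) (Finset.mem_range.2 hij)
  have h4 : ((1 : ℝ) / 2) ^ (j + 2) ≤ 1 / 2 := by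
    have := pow_le_pow_of_le_one (show (0 : ℝ) ≤ 1 / 2 by norm_num) (by norm_num)
      (show 1 ≤ j + 2 by lia)
    simpa using this
  have h5 : (m j)⁻¹ * ∑ i ∈ Finset.range j, m i < 1 / 2 := by linarith
  rw [inv_mul_lt_iff₀ (hpos j)] at h5
  linarith

end

theorem theorem3
    (X₀ X₁ : RISpace)
    (hstrict : StrictlyEmbedded X₀ X₁)
    (hnorm : ∀ f : L0, X₁.extNorm f ≤ X₀.extNorm f)
    (hφ₀ : X₀.fundamental 1 = 1) (hφ₁ : X₁.fundamental 1 = 1)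
    {E : Type*} [NormedAddCommGroup E] [NormedSpace ℝ E] [CompleteSpace E] [Lattice E]
    (e : SchauderBasis ℝ E) (he : IsNormalizedOneUnconditional e)
    (horder : ∀ x y : E, x ≤ y ↔ ∀ n, e.coord n x ≤ e.coord n y)
    (m : ℕ → ℝ) (hmono : Monotone m) (hm0 : 2 ≤ m 0)
    (hsum : Summable fun n => (m n)⁻¹)
    (hm : ∀ n, (m n)⁻¹ * ∑ i ∈ Finset.range n, m i + m n * ∑' i, (m (n + 1 + i))⁻¹
      < (1 / 2) ^ (n + 2)) :
    ∃ W : RISpace,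
      IsLionsPeetre e X₀ X₁ (fun n => (m n)⁻¹) m W.toBanachFunctionLattice ∧
      [IsDC E,
        ∀ u : ℕ → E, IsBlockBasis e u →
          ∃ φ : ℕ → ℕ, StrictMono φ ∧ IsComplementedSeq (u ∘ φ),
        IsDC W].TFAE := by
  obtain ⟨hle, hs⟩ := hstrict
  obtain ⟨hone, hone₀⟩ := RISpace.one_mem_and_norm_one hφ₀
  obtain ⟨hone', hone₁⟩ := RISpace.one_mem_and_norm_one hφ₁
  have hn : ∀ f : X₀, ‖(Submodule.inclusion hle f : X₁)‖ ≤ ‖f‖ := fun f => by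
    have := hnorm f
    rwa [X₀.extNorm_of_mem f.2, X₁.extNorm_of_mem (hle f.2),
      ENNReal.ofReal_le_ofReal_iff (norm_nonneg _)] at this
  have hm2 : ∀ n, 2 ≤ m n := fun n => hm0.trans (hmono (Nat.zero_le n))
  have hm1 : ∀ n, 1 ≤ m n := fun n => one_le_two.trans (hm2 n)
  refine ⟨lionsPeetreRI hle hm1 hs hn he hsum hone, ⟨fun f => Iff.rfl, fun f => rfl⟩, ?_⟩
  obtain ⟨g, hdisj, hg₀, hg₁, hgk⟩ := exists_disjoint_kSeq hle hone hm2
    (two_mul_le_of_lt hmono hm0 hm) hs hone₀ hone₁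
  obtain ⟨T, hTg, hT⟩ := exists_embedding hle hm1 hn he hsum hm hdisj hg₀ hg₁ hgk
  tfae_have 1 → 2 := IsDC.exists_isComplementedSeq_of_isBlockBasis he horder
  tfae_have 2 → 1 := isDC_of_isBlockBasis he horder
  tfae_have 2 → 3 := isDC_lionsPeetre hle hm1 hn he hsum hs
  tfae_have 3 → 2 := exists_isComplementedSeq_of_isDC_lionsPeetre hle hm1 hn he hdisj T hTg hT
  tfae_finish
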